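/- Let $(\mathbf X,Y,\Delta)$ be a random vector in $\mathbb R^d\times[-L,L]\times\{0,1\}$, $L<\infty$, where $\Delta=1$ if $Y$ is observed and $\Delta=0$ if $Y$ is missing. Let $\mu$ be the law of $\mathbf X$ and $m(\mathbf x)=E[Y\mid \mathbf X=\mathbf x]$. Assume that the selection probability $\pi(\mathbf x,y)=E[\Delta\mid \mathbf X=\mathbf x,Y=y]$ has the form $$\pi(\mathbf x,y)=\frac1{1+\exp\{g(\mathbf x)+\gamma^* y\}}$$ for some measurable $g:\mathbb R^d\to\mathbb R$ and $\gamma^*\in\mathbb R$, and that it is bounded below by a constant $\pi_{\min}>0$ (both almost everywhere with respect to the law of $(\mathbf X,Y)$). Let $(\mathbf X_i,Y_i,\Delta_i)$, $i\ge1$, be i.i.d. copies of $(\mathbf X,Y,\Delta)$ and let $\widehat\gamma=\widehat\gamma_n$ be any real random variables (estimators of $\gamma^*$) on the same probability space. Let $\mathcal K:\mathbb R^d\to[0,\infty)$ be a measurable kernel that is regular: there are $b,r>0$ such that $\mathcal K\ge b$ on the ball $S_{0,r}$ of radius $r$ centred at the origin, and $\int\sup_{\mathbf y\in\mathbf u+S_{0,r}}\mathcal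 K(\mathbf y)\,d\mathbf u<\infty$. Let the bandwidths $h=h_n>0$ satisfy $h\to0$ and $nh^d\to\infty$ as $n\to\infty$. For $k=1,2$ and $t\in\mathbb R$ put (with $0/0=0$) $$\widehat\eta_k(\mathbf x,t)=\frac{\sum_{i=1}^n\Delta_iY_i^{2-k}e^{tY_i}\mathcal K((\mathbf x-\mathbf X_i)/h)}{\sum_{i=1}^n\mathcal K((\mathbf x-\mathbf X_i)/h)},\qquad \widehat m_{n,\widehat\gamma}(\mathbf x)=\widehat\eta_1(\mathbf x,0)+\frac{\widehat\eta_1(\mathbf x,\widehat\gamma)}{\widehat\eta_2(\mathbf x,\widehat\gamma)}\bigl(1-\widehat\eta_2(\mathbf x,0)\bigr).$$ Then there are constants $c_1,c_3>0$ such that for every $\varepsilon>0$ and every $1\le p<\infty$ there are constants $c_2,C_0>0$, not depending on $n$ (but possibly on $\varepsilon$ and $p$), such that for all sufficiently large $n$ $$P\left\{\int\bigl|\widehat m_{n,\widehat\gamma}(\mathbf x)-m(\mathbf x)\bigr|^p\,\mu(d\mathbf x)>\varepsilon\right\}\le c_1e^{-c_2n}+c_3\,P\{|\widehat\gamma-\gamma^*|>C_0\}.$$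 -/

import Mathlib

open MeasureTheory ProbabilityTheory Filter Topology

namespace NMAR

/-- The space of observations `(x, y, δ)`: covariate `x ∈ ℝᵈ`, response `y`, and response
indicator `δ` (`δ = 1` if `y` is observed, `δ = 0` if it is missing). -/
abbrev Obs (d : ℕ) : Type := EuclideanSpace ℝ (Fin d) × ℝ × ℝ

/-- A regular kernel on `ℝᵈ`: a nonnegative (Borel) function `K` for which there are `b, r > 0`
with `K ≥ b` on the ball of radius `r` centred at the origin and
`∫ sup_{y ∈ u + S_{0,r}} K(y) du < ∞`. (As `r` is existentially quantified, open and closed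
balls give the same notion.) -/
structure IsRegularKernel {d : ℕ} (K : EuclideanSpace ℝ (Fin d) → ℝ) : Prop where
  measurable : Measurable K
  nonneg : ∀ u, 0 ≤ K u
  exists_ball : ∃ b : ℝ, 0 < b ∧ ∃ r : ℝ, 0 < r ∧
    (∀ u ∈ Metric.ball (0 : EuclideanSpace ℝ (Fin d)) r, b ≤ K u) ∧
    ∫⁻ u : EuclideanSpace ℝ (Fin d), ⨆ y ∈ Metric.ball u r, ENNReal.ofReal (K y) < ⊤

noncomputable section

/-- The law `μ` of the covariate `X` when `(X, Y, Δ)` has law `ν`. -/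
def covariateLaw {d : ℕ} (ν : Measure (Obs d)) : Measure (EuclideanSpace ℝ (Fin d)) :=
  ν.map (fun z => z.1)

/-- The regression function `m(x) = E[Y | X = x]` when `(X, Y, Δ)` has law `ν`. -/
def regressionFun {d : ℕ} (ν : Measure (Obs d)) [IsFiniteMeasure ν]
    (x : EuclideanSpace ℝ (Fin d)) : ℝ :=
  ∫ y, y ∂(condDistrib (fun z : Obs d => z.2.1) (fun z : Obs d => z.1) ν x)

/-- The selection probability `π(x, y) = E[Δ | X = x, Y = y]` when `(X, Y, Δ)` has law `ν`. -/
def selectionProb {d : ℕ} (ν : Measure (Obs d)) [IsFiniteMeasure ν]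
    (x : EuclideanSpace ℝ (Fin d)) (y : ℝ) : ℝ :=
  ∫ δ, δ ∂(condDistrib (fun z : Obs d => z.2.2) (fun z : Obs d => (z.1, z.2.1)) ν (x, y))

/-- The kernel estimator `η̂ₖ(x, t)`, `k = 1, 2`, of `E[Δ Y^(2-k) exp(t Y) | X = x]`
computed from the sample `D`, with `0 / 0 = 0`. -/
def etaHat {d n : ℕ} (K : EuclideanSpace ℝ (Fin d) → ℝ) (h : ℝ) (D : Fin n → Obs d)
    (k : ℕ) (t : ℝ) (x : EuclideanSpace ℝ (Fin d)) : ℝ :=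
  (∑ i, (D i).2.2 * (D i).2.1 ^ (2 - k) * Real.exp (t * (D i).2.1) * K (h⁻¹ • (x - (D i).1))) /
    ∑ i, K (h⁻¹ • (x - (D i).1))

/-- The plug-in estimator
`m̂(x) = η̂₁(x, 0) + (η̂₁(x, γ) / η̂₂(x, γ)) (1 - η̂₂(x, 0))`, with `0 / 0 = 0`. -/
def mHat {d n : ℕ} (K : EuclideanSpace ℝ (Fin d) → ℝ) (h : ℝ) (D : Fin n → Obs d)
    (γ : ℝ) (x : EuclideanSpace ℝ (Fin d)) : ℝ :=
  etaHat K h D 1 0 x + etaHat K h D 1 γ x / etaHat K h D 2 γ x * (1 - etaHat K h D 2 0 x)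

/-- The `Lᵖ(μ)`-type error `∫ |f(x) - m(x)|ᵖ μ(dx)` as an extended nonnegative number, where
`m` is the regression function and `μ` the covariate law under `ν`. -/
def lpError {d : ℕ} (ν : Measure (Obs d)) [IsFiniteMeasure ν] (p : ℝ)
    (f : EuclideanSpace ℝ (Fin d) → ℝ) : ENNReal :=
  ∫⁻ x, ENNReal.ofReal (|f x - regressionFun ν x| ^ p) ∂(covariateLaw ν)

end

end NMAR

/-!
With `π = 1 / (1 + exp(g + γ* y))` one has `1 - π = exp(g + γ* y) π`, so conditioning on `(X, Y)`
first gives `E[(1 - Δ) f(Y) | X] = exp(g(X)) E[Δ f(Y) exp(γ* Y) | X]` (`condExp_missing_ae_eq`).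
For `f = id` and `f = 1` this expresses `m` through regression functions of observed quantities,
`m = m₁ + (m₂ / m₃) (1 - m₄)` with `m₁, m₂, m₃, m₄` the regression functions of `ΔY`,
`ΔY exp(γ* Y)`, `Δ exp(γ* Y)`, `Δ`; the denominator `m₃` is bounded below because `π` is
(`ae_condMean_feature`). The estimator is the same functional of kernel averages.

The tilt parameter enters only through the ratio `η̂₁ / η̂₂`, a weighted mean of the observed
responses. Replacing `γ*` by `γ̂` changes every weight by a relative amount at most
`exp(L |γ̂ - γ*|) - 1`, so the estimator moves by at most a multiple of this, for every sample
(`abs_mHat_sub_mHat_le`). A small `C₀` therefore suffices and `γ̂` can be replaced by `γ*`.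

For the estimator with `γ*`, the random denominators of the kernel averages are replaced by the
deterministic `E K((x - X) / h)`: the error of the plug-in functional is at most a constant times
the sum of the errors of the resulting normalised sums for `1, ΔY, ΔY exp(γ* Y), Δ exp(γ* Y), Δ`
(`abs_mHat_sub_plugIn_le`). Each normalised sum is exponentially consistent in `L¹(μ)`
(`RegularKernel.exists_measureReal_l1Error_le`):

* Changing one observation changes the `L¹(μ)` error by `O(1 / n)`, uniformly in `h`, so McDiarmid's
  inequality (`measureReal_ge_le_of_bounded_differences`) bounds the deviation from the mean error.
* The bias vanishes (`RegularKernel.tendsto_bias`), by approximating the regression function by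
  continuous functions of compact support.
* The variance at `x` is at most a multiple of `1 / (n μ(B(x, r h)))`, whose integral over bounded
  sets is `O(1 / (n hᵈ))`.

The uniformity in `h` in all three steps comes from a single estimate,
`lintegral_div_measure_ball_le`: `∫ f(x) / μ(B(x, 2s)) μ(dx)` is at most the Lebesgue integral of
`u ↦ sup_{B(u, s)} f` divided by the volume of `B(0, s)`. Finally, estimator and target are
bounded, so the `Lᵖ` error for `p ≥ 1` is at most a constant times the `L¹` error.
-/

namespace NMAR

/-! ### Averaging over balls in place of covering arguments -/

section Ball

open Metric ENNReal

variable {E : Type*} [NormedAddCommGroup E]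

/-- The supremum of `k` over the open ball of radius `s` centred at `u`. -/
noncomputable def ballSup (k : E → ℝ≥0∞) (s : ℝ) (u : E) : ℝ≥0∞ := ⨆ y ∈ ball u s, k y

lemma le_ballSup (k : E → ℝ≥0∞) {s : ℝ} {u y : E} (hy : dist y u < s) : k y ≤ ballSup k s u :=
  le_iSup₂_of_le y hy le_rfl

variable [MeasurableSpace E] [BorelSpace E]

/-- A supremum over open balls is lower semicontinuous, whatever the function. -/
lemma measurable_ballSup (k : E → ℝ≥0∞) (s : ℝ) : Measurable (ballSup k s) := by
  refine measurable_of_Ioi fun a => IsOpen.measurableSet ?_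
  have : ballSup k s ⁻¹' Set.Ioi a = ⋃ y ∈ {y | a < k y}, ball y s := by
    ext u
    simp [ballSup, lt_iSup_iff, mem_ball, dist_comm, and_comm]
  rw [this]
  exact isOpen_biUnion fun _ _ => isOpen_ball

/-- The part of a regular kernel outside a growing ball contributes nothing in the limit. -/
lemma tendsto_lintegral_ballSup_tail (ρ : Measure E) {k : E → ℝ≥0∞} {r : ℝ}
    (hk : ∫⁻ v, ballSup k r v ∂ρ ≠ ⊤) {R : ℕ → ℝ} (hR : Tendsto R atTop atTop) :
    Tendsto (fun n => ∫⁻ v, ballSup ({u | R n ≤ ‖u‖}.indicator k) r v ∂ρ) atTop (𝓝 0) := by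
  rw [← lintegral_zero (μ := ρ)]
  refine tendsto_lintegral_of_dominated_convergence (ballSup k r)
    (fun n => measurable_ballSup _ _) (fun n => ae_of_all _ fun v => ?_) hk
    (ae_of_all _ fun v => ?_)
  · exact iSup₂_mono fun y _ => Set.indicator_le_self _ _ _
  · refine tendsto_const_nhds.congr' ?_
    filter_upwards [hR.eventually_gt_atTop (‖v‖ + r)] with n hn
    symm
    rw [← nonpos_iff_eq_zero]
    refine iSup₂_le fun y hy => ?_
    rw [Set.indicator_of_notMem]
    rw [Set.mem_ofPred_eq, not_le]
    rw [mem_ball, dist_eq_norm] at hy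
    have := norm_add_le (y - v) v
    rw [sub_add_cancel] at this
    linarith

variable [NormedSpace ℝ E] [FiniteDimensional ℝ E]

/-- The `μ`-integral of `f` against the reciprocal ball masses is controlled by a Lebesgue
integral: `1` is the average over `u ∈ B(x, s)`, for such `u` one has `B(u, s) ⊆ B(x, 2s)`, and
after exchanging the integrals the `μ`-mass of `B(u, s)` cancels. -/
lemma lintegral_div_measure_ball_le (μ ρ : Measure E) [IsFiniteMeasure μ] [ρ.IsAddHaarMeasure]
    {f : E → ℝ≥0∞} (hf : Measurable f) {s : ℝ} (hs : 0 < s) :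
    ∫⁻ x, f x / μ (ball x (2 * s)) ∂μ ≤ (ρ (ball 0 s))⁻¹ * ∫⁻ u, ballSup f s u ∂ρ := by
  have hv0 : ρ (ball 0 s) ≠ 0 := (measure_ball_pos ρ 0 hs).ne'
  have hvt : ρ (ball 0 s) ≠ ⊤ := measure_ball_lt_top.ne
  have hmeas : Measurable fun u => μ (ball u s) := by
    have : MeasurableSet {p : E × E | dist p.2 p.1 < s} :=
      (isOpen_lt (by fun_prop) continuous_const).measurableSet
    exact measurable_measure_prodMk_left this
  have hD : MeasurableSet {p : E × E | dist p.1 p.2 < s} :=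
    (isOpen_lt (by fun_prop) continuous_const).measurableSet
  set F : E → E → ℝ≥0∞ := fun x u =>
    {p : E × E | dist p.1 p.2 < s}.indicator (fun p => f p.1 / μ (ball p.2 s)) (x, u) with hF
  have hFm : Measurable (Function.uncurry F) :=
    Measurable.indicator ((hf.comp measurable_fst).div (hmeas.comp measurable_snd)) hD
  have h1 : ∀ x, ρ (ball 0 s) * (f x / μ (ball x (2 * s))) ≤ ∫⁻ u, F x u ∂ρ := by
    intro x
    have : ρ (ball 0 s) = ρ (ball x s) := (Measure.addHaar_ball_center ρ x s).symm
    rw [this, mul_comm, ← setLIntegral_const, ← lintegral_indicator measurableSet_ball]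
    refine lintegral_mono fun u => ?_
    by_cases hu : dist x u < s
    · have hu' : u ∈ ball x s := by rwa [mem_ball, dist_comm]
      simp only [hF, Set.indicator_of_mem hu',
        Set.indicator_of_mem (show (x, u) ∈ {p : E × E | dist p.1 p.2 < s} from hu)]
      gcongr
      intro w hw
      have := dist_triangle w u x
      rw [mem_ball] at hw hu' ⊢
      linarith
    · have hu' : u ∉ ball x s := by rwa [mem_ball, dist_comm]
      simp [Set.indicator_of_notMem hu']
  have h2 : ∀ u, ∫⁻ x, F x u ∂μ ≤ ballSup f s u := by
    intro u
    calc ∫⁻ x, F x u ∂μ ≤ ∫⁻ x in ball u s, ballSup f s u / μ (ball u s) ∂μ := by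
          rw [← lintegral_indicator measurableSet_ball]
          refine lintegral_mono fun x => ?_
          by_cases hu : dist x u < s
          · simp only [hF, Set.indicator_of_mem (show x ∈ ball u s from hu),
              Set.indicator_of_mem (show (x, u) ∈ {p : E × E | dist p.1 p.2 < s} from hu)]
            gcongr
            exact le_ballSup f hu
          · have : (x, u) ∉ {p : E × E | dist p.1 p.2 < s} := hu
            simp [hF, Set.indicator_of_notMem this]
      _ = ballSup f s u / μ (ball u s) * μ (ball u s) := by rw [setLIntegral_const]
      _ ≤ ballSup f s u := by rw [mul_comm]; exact ENNReal.mul_div_le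
  rw [← ENNReal.div_eq_inv_mul, ENNReal.le_div_iff_mul_le (Or.inl hv0) (Or.inl hvt), mul_comm]
  calc ρ (ball 0 s) * ∫⁻ x, f x / μ (ball x (2 * s)) ∂μ
      = ∫⁻ x, ρ (ball 0 s) * (f x / μ (ball x (2 * s))) ∂μ :=
        (lintegral_const_mul' _ _ hvt).symm
    _ ≤ ∫⁻ x, ∫⁻ u, F x u ∂ρ ∂μ := lintegral_mono h1
    _ = ∫⁻ u, ∫⁻ x, F x u ∂μ ∂ρ := lintegral_lintegral_swap hFm.aemeasurable
    _ ≤ _ := lintegral_mono h2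

/-- Change of variables for the rescaling of the kernel. -/
lemma lintegral_comp_rescale (ρ : Measure E) [ρ.IsAddHaarMeasure] (G : E → ℝ≥0∞)
    (hG : Measurable G) (z : E) {h : ℝ} (hh : 0 < h) :
    ∫⁻ u, G (h⁻¹ • (u - z)) ∂ρ = ENNReal.ofReal (h ^ Module.finrank ℝ E) * ∫⁻ v, G v ∂ρ := by
  rw [lintegral_sub_right_eq_self (fun u => G (h⁻¹ • u)) z,
    ← lintegral_map hG (measurable_const_smul h⁻¹),
    Measure.map_addHaar_smul ρ (inv_ne_zero hh.ne'), lintegral_smul_measure]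
  congr 2
  rw [abs_of_pos (by positivity)]
  simp

/-- The basic estimate for kernel weights: the `μ`-integral over the evaluation point of a
rescaled kernel divided by the mass of the bandwidth ball is bounded uniformly in the
bandwidth `h` and in the centre `z`. -/
lemma lintegral_kernel_div_measure_ball_le (μ ρ : Measure E) [IsFiniteMeasure μ]
    [ρ.IsAddHaarMeasure] {k : E → ℝ≥0∞} (hk : Measurable k) (z : E) {h r : ℝ} (hh : 0 < h)
    (hr : 0 < r) :
    ∫⁻ x, k (h⁻¹ • (x - z)) / μ (ball x (r * h)) ∂μ ≤
      (ρ (ball 0 (r / 2)))⁻¹ * ∫⁻ v, ballSup k r v ∂ρ := by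
  have key := lintegral_div_measure_ball_le μ ρ (f := fun x => k (h⁻¹ • (x - z)))
    (hk.comp (by fun_prop)) (s := r / 2 * h) (by positivity)
  rw [show 2 * (r / 2 * h) = r * h by ring] at key
  refine key.trans ?_
  have hsup : ∀ u, ballSup (fun x => k (h⁻¹ • (x - z))) (r / 2 * h) u ≤
      ballSup k r (h⁻¹ • (u - z)) := by
    intro u
    refine iSup₂_le fun y hy => le_ballSup k ?_
    rw [mem_ball] at hy
    rw [dist_smul₀, dist_sub_right, Real.norm_of_nonneg (by positivity), inv_mul_lt_iff₀ hh]
    nlinarith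
  have hvol : ρ (ball 0 (r / 2 * h)) =
      ENNReal.ofReal (h ^ Module.finrank ℝ E) * ρ (ball 0 (r / 2)) := by
    rw [mul_comm, Measure.addHaar_ball_mul_of_pos ρ 0 hh]
  have hp0 : ENNReal.ofReal (h ^ Module.finrank ℝ E) ≠ 0 := by
    simpa using pow_pos hh _
  calc _ ≤ (ρ (ball 0 (r / 2 * h)))⁻¹ * ∫⁻ u, ballSup k r (h⁻¹ • (u - z)) ∂ρ := by
        gcongr with u; exact hsup u
    _ = _ := by
        rw [lintegral_comp_rescale ρ _ (measurable_ballSup k r) z hh, hvol,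
          ENNReal.mul_inv (Or.inl hp0) (Or.inl ENNReal.ofReal_ne_top), ← mul_assoc,
          mul_right_comm _ _ (ENNReal.ofReal _),
          ENNReal.inv_mul_cancel hp0 ENNReal.ofReal_ne_top, one_mul]

/-- On a bounded set the reciprocal mass of the bandwidth ball has integral `O(h⁻ᵈ)`. -/
lemma lintegral_inv_measure_ball_le (μ ρ : Measure E) [IsFiniteMeasure μ]
    [ρ.IsAddHaarMeasure] {h r R : ℝ} (hh : 0 < h) (hr : 0 < r) :
    ∫⁻ x in ball 0 R, (μ (ball x (r * h)))⁻¹ ∂μ ≤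
      (ENNReal.ofReal (h ^ Module.finrank ℝ E) * ρ (ball 0 (r / 2)))⁻¹ *
        ρ (ball 0 (R + r / 2 * h)) := by
  have key := lintegral_div_measure_ball_le μ ρ (f := (ball (0 : E) R).indicator 1)
    (measurable_one.indicator measurableSet_ball) (s := r / 2 * h) (by positivity)
  rw [show 2 * (r / 2 * h) = r * h by ring, mul_comm (r / 2) h,
    Measure.addHaar_ball_mul_of_pos ρ 0 hh] at key
  rw [← lintegral_indicator measurableSet_ball]
  calc _ = ∫⁻ x, (ball (0 : E) R).indicator 1 x / μ (ball x (r * h)) ∂μ := by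
        refine lintegral_congr fun x => ?_
        by_cases hx : x ∈ ball (0 : E) R
        · simp only [Set.indicator_of_mem hx, Pi.one_apply, one_div]
        · simp only [Set.indicator_of_notMem hx, ENNReal.zero_div]
    _ ≤ _ := key
    _ ≤ _ := by
        gcongr
        rw [← lintegral_indicator_one measurableSet_ball]
        refine lintegral_mono fun u => iSup₂_le fun y hy => ?_
        by_cases hyR : y ∈ ball (0 : E) R
        · have : u ∈ ball (0 : E) (R + r / 2 * h) := by
            rw [mem_ball] at *
            have := dist_triangle u y 0
            rw [dist_comm u y] at this
            linarith
          simp [Set.indicator_of_mem hyR, Set.indicator_of_mem this]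
        · simp [Set.indicator_of_notMem hyR]

/-- A kernel whose ball suprema are integrable is bounded. -/
lemma exists_forall_le_of_lintegral_ballSup (ρ : Measure E) [ρ.IsAddHaarMeasure]
    {k : E → ℝ≥0∞} {r : ℝ} (hr : 0 < r) (hk : ∫⁻ v, ballSup k r v ∂ρ ≠ ⊤) :
    ∃ C : ℝ≥0∞, C ≠ ⊤ ∧ ∀ y, k y ≤ C := by
  have hv0 : ρ (ball 0 r) ≠ 0 := (measure_ball_pos ρ 0 hr).ne'
  have hvt : ρ (ball 0 r) ≠ ⊤ := measure_ball_lt_top.ne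
  refine ⟨(∫⁻ v, ballSup k r v ∂ρ) / ρ (ball 0 r), ENNReal.div_ne_top hk hv0, fun y => ?_⟩
  rw [ENNReal.le_div_iff_mul_le (Or.inl hv0) (Or.inl hvt), ← Measure.addHaar_ball_center ρ y,
    ← setLIntegral_const, ← lintegral_indicator measurableSet_ball]
  refine lintegral_mono fun u => Set.indicator_apply_le' (fun hu => le_ballSup k ?_)
    fun _ => zero_le
  rwa [dist_comm]

end Ball

/-! ### Kernel weights -/

section Weight

open Metric ENNReal

lemma lintegral_lintegral_le_add_add {α β : Type*} [MeasurableSpace α] [MeasurableSpace β]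
    {μ : Measure α} {ν : Measure β} [SFinite ν] {f : α → β → ℝ≥0∞} {A B C : α × β → ℝ≥0∞}
    (hA : Measurable A) (hB : Measurable B)
    (hle : ∀ x z, f x z ≤ A (x, z) + (B (x, z) + C (x, z))) :
    ∫⁻ x, ∫⁻ z, f x z ∂ν ∂μ ≤ ∫⁻ x, ∫⁻ z, A (x, z) ∂ν ∂μ +
      (∫⁻ x, ∫⁻ z, B (x, z) ∂ν ∂μ + ∫⁻ x, ∫⁻ z, C (x, z) ∂ν ∂μ) := by
  rw [← lintegral_add_left hB.lintegral_prod_right', ← lintegral_add_left hA.lintegral_prod_right']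
  refine lintegral_mono fun x => ?_
  have hAx : Measurable fun z => A (x, z) := hA.comp measurable_prodMk_left
  have hBx : Measurable fun z => B (x, z) := hB.comp measurable_prodMk_left
  rw [← lintegral_add_left hBx, ← lintegral_add_left hAx]
  exact lintegral_mono fun z => hle x z

variable {E : Type*} [NormedAddCommGroup E] [MeasurableSpace E]

/-- A regular kernel with explicit constants: `K ≥ b` on the ball of radius `r` around the
origin, and the suprema of `K` over balls of radius `r` are `ρ`-integrable. -/
structure RegularKernel (ρ : Measure E) (K : E → ℝ) (b r : ℝ) : Prop where
  measurable : Measurable K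
  nonneg : ∀ u, 0 ≤ K u
  b_pos : 0 < b
  r_pos : 0 < r
  le_of_mem_ball : ∀ u ∈ ball (0 : E) r, b ≤ K u
  lintegral_ne_top : ∫⁻ v, ballSup (fun u => ENNReal.ofReal (K u)) r v ∂ρ ≠ ⊤

variable [NormedSpace ℝ E]

/-- The expected kernel mass `E K((x - X) / h)` at `x`, for `X` with law `μ`. -/
noncomputable def kernelMass (μ : Measure E) (K : E → ℝ) (h : ℝ) (x : E) : ℝ :=
  ∫ w, K (h⁻¹ • (x - w)) ∂μ

/-- The kernel at `x - z` normalised by its expected mass. Replacing the random denominator of the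
kernel estimate by this deterministic one makes the estimate a sum of independent terms.
Where the expected mass vanishes, a `μ`-null set by `RegularKernel.ae_kernelMass_pos`, the weight
is `0`. -/
noncomputable def weight (μ : Measure E) (K : E → ℝ) (h : ℝ) (x z : E) : ℝ :=
  K (h⁻¹ • (x - z)) / kernelMass μ K h x

lemma kernelMass_nonneg {μ : Measure E} {K : E → ℝ} (hK : ∀ u, 0 ≤ K u) (h : ℝ) (x : E) :
    0 ≤ kernelMass μ K h x := integral_nonneg fun _ => hK _

lemma weight_nonneg {μ : Measure E} {K : E → ℝ} (hK : ∀ u, 0 ≤ K u) (h : ℝ) (x z : E) :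
    0 ≤ weight μ K h x z := div_nonneg (hK _) (kernelMass_nonneg hK h x)

lemma integral_weight {μ : Measure E} {K : E → ℝ} {h : ℝ} {x : E}
    (hx : 0 < kernelMass μ K h x) : ∫ z, weight μ K h x z ∂μ = 1 := by
  simp only [weight, integral_div]
  exact div_self hx.ne'

lemma ofReal_weight_le {μ : Measure E} {K : E → ℝ} (hK : ∀ u, 0 ≤ K u) (h : ℝ) (x z : E) :
    ENNReal.ofReal (weight μ K h x z) ≤
      ENNReal.ofReal (K (h⁻¹ • (x - z))) / ENNReal.ofReal (kernelMass μ K h x) := by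
  rcases (kernelMass_nonneg (μ := μ) hK h x).eq_or_lt with h0 | h0
  · simp [weight, ← h0]
  · rw [weight, ENNReal.ofReal_div_of_pos h0]

variable [BorelSpace E] [FiniteDimensional ℝ E]

lemma measurable_kernelMass {μ : Measure E} [IsProbabilityMeasure μ] {K : E → ℝ}
    (hK : Measurable K) (h : ℝ) : Measurable (kernelMass μ K h) := by
  have : Measurable fun p : E × E => K (h⁻¹ • (p.1 - p.2)) := hK.comp (by fun_prop)
  exact (this.stronglyMeasurable.integral_prod_right' (ν := μ)).measurable

lemma measurable_weight {μ : Measure E} [IsProbabilityMeasure μ] {K : E → ℝ}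
    (hK : Measurable K) (h : ℝ) : Measurable fun p : E × E => weight μ K h p.1 p.2 :=
  (hK.comp (by fun_prop)).div ((measurable_kernelMass hK h).comp measurable_fst)

namespace RegularKernel

variable {μ ρ : Measure E} [IsProbabilityMeasure μ] [ρ.IsAddHaarMeasure] {K : E → ℝ} {b r : ℝ}

lemma exists_bound (hK : RegularKernel ρ K b r) : ∃ C : ℝ, 0 < C ∧ ∀ u, K u ≤ C := by
  obtain ⟨C, hC, hle⟩ := exists_forall_le_of_lintegral_ballSup ρ hK.r_pos hK.lintegral_ne_top
  refine ⟨C.toReal + 1, by positivity, fun u => ?_⟩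
  have := (ENNReal.ofReal_le_iff_le_toReal hC).1 (hle u)
  linarith

lemma integrable_comp (hK : RegularKernel ρ K b r) (h : ℝ) (x : E) :
    Integrable (fun w => K (h⁻¹ • (x - w))) μ := by
  obtain ⟨C, -, hC⟩ := hK.exists_bound
  refine Integrable.of_bound (hK.measurable.comp (by fun_prop)).aestronglyMeasurable C
    (ae_of_all _ fun w => ?_)
  rw [Real.norm_of_nonneg (hK.nonneg _)]
  exact hC _

lemma measure_ball_le_kernelMass (hK : RegularKernel ρ K b r) {h : ℝ} (hh : 0 < h) (x : E) :
    ENNReal.ofReal b * μ (ball x (r * h)) ≤ ENNReal.ofReal (kernelMass μ K h x) := by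
  rw [kernelMass, ofReal_integral_eq_lintegral_ofReal (hK.integrable_comp h x)
    (ae_of_all _ fun _ => hK.nonneg _), ← setLIntegral_const,
    ← lintegral_indicator measurableSet_ball]
  refine lintegral_mono fun w => Set.indicator_apply_le' (fun hw => ?_) fun _ => zero_le
  refine ENNReal.ofReal_le_ofReal (hK.le_of_mem_ball _ ?_)
  rw [mem_ball, dist_comm, dist_eq_norm] at hw
  rw [mem_ball_zero_iff, norm_smul, Real.norm_of_nonneg (by positivity), inv_mul_lt_iff₀ hh]
  linarith

/-- Almost every point charges all balls around it, so the expected kernel mass is positive. -/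
lemma ae_kernelMass_pos (hK : RegularKernel ρ K b r) {h : ℝ} (hh : 0 < h) :
    ∀ᵐ x ∂μ, 0 < kernelMass μ K h x := by
  filter_upwards [Measure.support_mem_ae (μ := μ)] with x hx
  have h1 : 0 < μ (ball x (r * h)) :=
    Measure.mem_support_iff_forall x |>.1 hx _ (ball_mem_nhds x (mul_pos hK.r_pos hh))
  have h2 := (ENNReal.mul_pos (ENNReal.ofReal_pos.2 hK.b_pos).ne' h1.ne').trans_le
    (hK.measure_ball_le_kernelMass hh x)
  exact ENNReal.ofReal_pos.1 h2

lemma integrable_weight (hK : RegularKernel ρ K b r) (h : ℝ) (x : E) :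
    Integrable (weight μ K h x) μ := (hK.integrable_comp h x).div_const _

lemma lintegral_weight_le (hK : RegularKernel ρ K b r) (h : ℝ) (x : E) :
    ∫⁻ z, ENNReal.ofReal (weight μ K h x z) ∂μ ≤ 1 := by
  rw [← ofReal_integral_eq_lintegral_ofReal (hK.integrable_weight h x)
    (ae_of_all _ fun _ => weight_nonneg hK.nonneg _ _ _), ENNReal.ofReal_le_one]
  simp only [weight, integral_div]
  exact div_self_le_one _

/-- Integrating normalised kernel weights over the evaluation point gives a quantity bounded
uniformly in the bandwidth and in the data point; `k` is `K` or a truncation of it. -/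
lemma lintegral_div_kernelMass_le (hK : RegularKernel ρ K b r) {k : E → ℝ≥0∞}
    (hk : Measurable k) (z : E) {h : ℝ} (hh : 0 < h) :
    ∫⁻ x, k (h⁻¹ • (x - z)) / ENNReal.ofReal (kernelMass μ K h x) ∂μ ≤
      (ENNReal.ofReal b)⁻¹ * ((ρ (ball 0 (r / 2)))⁻¹ * ∫⁻ v, ballSup k r v ∂ρ) := by
  have hb0 : ENNReal.ofReal b ≠ 0 := (ENNReal.ofReal_pos.2 hK.b_pos).ne'
  refine le_trans ?_ (mul_le_mul_right
    (lintegral_kernel_div_measure_ball_le μ ρ hk z hh hK.r_pos) _)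
  rw [← lintegral_const_mul' _ _ (ENNReal.inv_ne_top.2 hb0)]
  refine lintegral_mono fun x => ?_
  calc k (h⁻¹ • (x - z)) / ENNReal.ofReal (kernelMass μ K h x)
      ≤ k (h⁻¹ • (x - z)) / (ENNReal.ofReal b * μ (ball x (r * h))) := by
        gcongr
        exact hK.measure_ball_le_kernelMass hh x
    _ = _ := by
        rw [ENNReal.div_eq_inv_mul, ENNReal.div_eq_inv_mul,
          ENNReal.mul_inv (Or.inl hb0) (Or.inl ENNReal.ofReal_ne_top), mul_assoc]

lemma exists_lintegral_weight_le (hK : RegularKernel ρ K b r) :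
    ∃ c : ℝ, 0 < c ∧ ∀ h : ℝ, 0 < h → ∀ z,
      ∫⁻ x, ENNReal.ofReal (weight μ K h x z) ∂μ ≤ ENNReal.ofReal c := by
  set c := (ENNReal.ofReal b)⁻¹ * ((ρ (ball 0 (r / 2)))⁻¹ *
    ∫⁻ v, ballSup (fun u => ENNReal.ofReal (K u)) r v ∂ρ)
  have hc : c ≠ ⊤ := ENNReal.mul_ne_top
    (ENNReal.inv_ne_top.2 (ENNReal.ofReal_pos.2 hK.b_pos).ne')
    (ENNReal.mul_ne_top (ENNReal.inv_ne_top.2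
      (measure_ball_pos ρ 0 (half_pos hK.r_pos)).ne') hK.lintegral_ne_top)
  refine ⟨c.toReal + 1, by positivity, fun h hh z => ?_⟩
  calc _ ≤ ∫⁻ x, ENNReal.ofReal (K (h⁻¹ • (x - z))) / ENNReal.ofReal (kernelMass μ K h x) ∂μ :=
        lintegral_mono fun x => ofReal_weight_le hK.nonneg h x z
    _ ≤ c := hK.lintegral_div_kernelMass_le hK.measurable.ennreal_ofReal z hh
    _ = ENNReal.ofReal c.toReal := (ENNReal.ofReal_toReal hc).symm
    _ ≤ _ := ENNReal.ofReal_le_ofReal (by linarith)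

/-- The smoothing bias vanishes in `L¹(μ)` for every integrable function: approximate by a
compactly supported continuous function and use the uniform bound on the integrated weights. -/
lemma tendsto_bias (hK : RegularKernel ρ K b r) {h : ℕ → ℝ} (hpos : ∀ n, 0 < h n)
    (hh : Tendsto h atTop (𝓝 0)) {m : E → ℝ} (hm : Measurable m) (hmi : Integrable m μ) :
    Tendsto (fun n => ∫⁻ x, ∫⁻ z, ENNReal.ofReal (weight μ K (h n) x z) * ‖m z - m x‖ₑ ∂μ ∂μ)
      atTop (𝓝 0) := by
  obtain ⟨c, hc0, hc⟩ := hK.exists_lintegral_weight_le (μ := μ)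
  rw [ENNReal.tendsto_nhds_zero]
  intro ε hε
  obtain ⟨η, hη0, hηε⟩ : ∃ η : ℝ, 0 < η ∧ ENNReal.ofReal ((c + 3) * η) ≤ ε := by
    rcases eq_or_ne ε ⊤ with rfl | hεt
    · exact ⟨1, one_pos, le_top⟩
    · refine ⟨ε.toReal / (c + 3), div_pos (ENNReal.toReal_pos hε.ne' hεt) (by positivity), ?_⟩
      rw [mul_div_cancel₀ _ (by positivity), ENNReal.ofReal_toReal hεt]
  obtain ⟨φ, hφs, hφm, hφc, hφi⟩ := hmi.exists_hasCompactSupport_lintegral_sub_le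
    (ε := ENNReal.ofReal η) (ENNReal.ofReal_pos.2 hη0).ne'
  have hφu : UniformContinuous φ := hφs.uniformContinuous_of_continuous hφc
  obtain ⟨M, hM⟩ := hφs.exists_bound_of_continuous hφc
  have hM0 : 0 ≤ M := (norm_nonneg _).trans (hM 0)
  obtain ⟨δ, hδ0, hδ⟩ := Metric.uniformContinuous_iff.1 hφu η hη0
  set k : E → ℝ≥0∞ := fun u => ENNReal.ofReal (K u) with hk
  set c' := ENNReal.ofReal (2 * M) * ((ENNReal.ofReal b)⁻¹ * (ρ (ball 0 (r / 2)))⁻¹)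
  have hc't : c' ≠ ⊤ := ENNReal.mul_ne_top ENNReal.ofReal_ne_top (ENNReal.mul_ne_top
    (ENNReal.inv_ne_top.2 (ENNReal.ofReal_pos.2 hK.b_pos).ne') (ENNReal.inv_ne_top.2
      (measure_ball_pos ρ 0 (half_pos hK.r_pos)).ne'))
  have hR : Tendsto (fun n => δ / h n) atTop atTop :=
    Tendsto.const_mul_atTop hδ0 (tendsto_inv_nhdsGT_zero.comp
      (tendsto_nhdsWithin_iff.2 ⟨hh, Eventually.of_forall hpos⟩))
  have htail : Tendsto (fun n => c' * ∫⁻ v, ballSup ({u | δ / h n ≤ ‖u‖}.indicator k) r v ∂ρ)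
      atTop (𝓝 0) := by
    simpa using ENNReal.Tendsto.const_mul
      (tendsto_lintegral_ballSup_tail ρ hK.lintegral_ne_top hR) (Or.inr hc't)
  filter_upwards [(ENNReal.tendsto_nhds_zero.1 htail) _ (ENNReal.ofReal_pos.2 hη0)] with n hn
  refine le_trans ?_ hηε
  have hw : Measurable fun p : E × E => ENNReal.ofReal (weight μ K (h n) p.1 p.2) :=
    (measurable_weight hK.measurable _).ennreal_ofReal
  have hwx : ∀ x, Measurable fun z => ENNReal.ofReal (weight μ K (h n) x z) := fun x =>
    hw.comp measurable_prodMk_left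
  have hφm' : Measurable φ := hφc.measurable
  -- the part of the weight coming from points at distance at least `δ`
  set I : E → E → ℝ≥0∞ := fun x z =>
    ({u | δ / h n ≤ ‖u‖}.indicator k) ((h n)⁻¹ • (x - z)) /
      ENNReal.ofReal (kernelMass μ K (h n) x) with hI
  have hkI : Measurable ({u : E | δ / h n ≤ ‖u‖}.indicator k) :=
    hK.measurable.ennreal_ofReal.indicator
      (isClosed_le continuous_const continuous_norm).measurableSet
  have hIm : Measurable fun p : E × E => I p.1 p.2 :=
    (hkI.comp (by fun_prop)).div
      (((measurable_kernelMass hK.measurable _).comp measurable_fst).ennreal_ofReal)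
  have hpt : ∀ x z, ENNReal.ofReal (weight μ K (h n) x z) * ‖m z - m x‖ₑ ≤
      ENNReal.ofReal (weight μ K (h n) x z) * ‖m z - φ z‖ₑ +
      (ENNReal.ofReal (2 * M) * I x z +
      (ENNReal.ofReal (weight μ K (h n) x z) * (ENNReal.ofReal η + ‖m x - φ x‖ₑ))) := by
    intro x z
    have h1 : ‖m z - m x‖ₑ ≤ ‖m z - φ z‖ₑ + ‖φ z - φ x‖ₑ + ‖m x - φ x‖ₑ := by
      rw [show m z - m x = (m z - φ z) + (φ z - φ x) + (φ x - m x) by ring, enorm_sub_rev (m x)]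
      exact (enorm_add_le _ _).trans (add_le_add_left (enorm_add_le _ _) _)
    have h2 : ENNReal.ofReal (weight μ K (h n) x z) * ‖φ z - φ x‖ₑ ≤
        ENNReal.ofReal (2 * M) * I x z +
          ENNReal.ofReal (weight μ K (h n) x z) * ENNReal.ofReal η := by
      by_cases hd : dist z x < δ
      · refine le_add_left ?_
        gcongr
        rw [← ofReal_norm, ← dist_eq_norm]
        exact ENNReal.ofReal_le_ofReal (hδ hd).le
      · refine le_add_right ?_
        rw [mul_comm]
        gcongr
        · rw [← ofReal_norm]
          refine ENNReal.ofReal_le_ofReal ((norm_sub_le _ _).trans ?_)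
          linarith [hM z, hM x]
        · refine (ofReal_weight_le hK.nonneg _ x z).trans_eq ?_
          rw [hI]
          simp only
          rw [Set.indicator_of_mem]
          rw [Set.mem_ofPred_eq, norm_smul, norm_inv, Real.norm_of_nonneg (hpos n).le,
            div_eq_inv_mul]
          have := hpos n
          rw [not_lt, dist_comm, dist_eq_norm] at hd
          gcongr
    calc _ ≤ ENNReal.ofReal (weight μ K (h n) x z) *
          (‖m z - φ z‖ₑ + ‖φ z - φ x‖ₑ + ‖m x - φ x‖ₑ) := by gcongr
      _ = ENNReal.ofReal (weight μ K (h n) x z) * ‖m z - φ z‖ₑ +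
          (ENNReal.ofReal (weight μ K (h n) x z) * ‖φ z - φ x‖ₑ +
            ENNReal.ofReal (weight μ K (h n) x z) * ‖m x - φ x‖ₑ) := by ring
      _ ≤ ENNReal.ofReal (weight μ K (h n) x z) * ‖m z - φ z‖ₑ +
          ((ENNReal.ofReal (2 * M) * I x z +
            ENNReal.ofReal (weight μ K (h n) x z) * ENNReal.ofReal η) +
            ENNReal.ofReal (weight μ K (h n) x z) * ‖m x - φ x‖ₑ) := by gcongr
      _ = _ := by ring
  have hAm : Measurable fun p : E × E =>
      ENNReal.ofReal (weight μ K (h n) p.1 p.2) * ‖m p.2 - φ p.2‖ₑ :=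
    hw.mul ((hm.sub hφm').enorm.comp measurable_snd)
  have hA : ∫⁻ x, ∫⁻ z, ENNReal.ofReal (weight μ K (h n) x z) * ‖m z - φ z‖ₑ ∂μ ∂μ ≤
      ENNReal.ofReal (c * η) := by
    rw [lintegral_lintegral_swap hAm.aemeasurable]
    calc _ = ∫⁻ z, (∫⁻ x, ENNReal.ofReal (weight μ K (h n) x z) ∂μ) * ‖m z - φ z‖ₑ ∂μ :=
          lintegral_congr fun z => lintegral_mul_const _ (hw.comp measurable_prodMk_right)
      _ ≤ ∫⁻ z, ENNReal.ofReal c * ‖m z - φ z‖ₑ ∂μ := by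
          gcongr with z
          exact hc _ (hpos n) z
      _ = ENNReal.ofReal c * ∫⁻ z, ‖m z - φ z‖ₑ ∂μ :=
          lintegral_const_mul' _ _ ENNReal.ofReal_ne_top
      _ ≤ _ := by
          rw [ENNReal.ofReal_mul hc0.le]
          gcongr
  have hB : ∫⁻ x, ∫⁻ z, ENNReal.ofReal (2 * M) * I x z ∂μ ∂μ ≤ ENNReal.ofReal η := by
    rw [lintegral_lintegral_swap (hIm.const_mul _).aemeasurable]
    refine le_trans ?_ hn
    calc _ = ∫⁻ z, ENNReal.ofReal (2 * M) * ∫⁻ x, I x z ∂μ ∂μ :=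
          lintegral_congr fun z => lintegral_const_mul' _ _ ENNReal.ofReal_ne_top
      _ ≤ ∫⁻ z, c' * ∫⁻ v, ballSup ({u | δ / h n ≤ ‖u‖}.indicator k) r v ∂ρ ∂μ := by
          refine lintegral_mono fun z => ?_
          rw [mul_assoc, mul_assoc]
          gcongr
          exact hK.lintegral_div_kernelMass_le hkI z (hpos n)
      _ = _ := by simp
  have hC : ∫⁻ x, ∫⁻ z, ENNReal.ofReal (weight μ K (h n) x z) *
      (ENNReal.ofReal η + ‖m x - φ x‖ₑ) ∂μ ∂μ ≤ ENNReal.ofReal η + ENNReal.ofReal η := by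
    calc _ = ∫⁻ x, (∫⁻ z, ENNReal.ofReal (weight μ K (h n) x z) ∂μ) *
          (ENNReal.ofReal η + ‖m x - φ x‖ₑ) ∂μ :=
          lintegral_congr fun x => lintegral_mul_const _ (hwx x)
      _ ≤ ∫⁻ x, 1 * (ENNReal.ofReal η + ‖m x - φ x‖ₑ) ∂μ := by
          gcongr with x
          exact hK.lintegral_weight_le _ x
      _ = ENNReal.ofReal η + ∫⁻ x, ‖m x - φ x‖ₑ ∂μ := by
          simp only [one_mul]
          rw [lintegral_add_left measurable_const]
          simp
      _ ≤ _ := by gcongr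
  calc _ ≤ _ := lintegral_lintegral_le_add_add (μ := μ) (ν := μ) hAm
        (hIm.const_mul (ENNReal.ofReal (2 * M))) (C := fun p =>
          ENNReal.ofReal (weight μ K (h n) p.1 p.2) * (ENNReal.ofReal η + ‖m p.1 - φ p.1‖ₑ)) hpt
    _ ≤ ENNReal.ofReal (c * η) + (ENNReal.ofReal η + (ENNReal.ofReal η + ENNReal.ofReal η)) :=
        add_le_add hA (add_le_add hB hC)
    _ = _ := by
        rw [← ENNReal.ofReal_add hη0.le hη0.le, ← ENNReal.ofReal_add hη0.le (by positivity),
          ← ENNReal.ofReal_add (by positivity) (by positivity)]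
        congr 1; ring

end RegularKernel

end Weight

/-! ### The bounded differences inequality -/

section BoundedDifferences

variable {α : Type*} [MeasurableSpace α] (ν : Measure α) [IsProbabilityMeasure ν]

lemma integral_pi_succ {n : ℕ} (F : (Fin (n + 1) → α) → ℝ)
    (hF : Integrable F (Measure.pi fun _ => ν)) :
    ∫ z, F z ∂(Measure.pi fun _ => ν) =
      ∫ z', ∫ a, F (Fin.cons a z') ∂ν ∂(Measure.pi fun _ : Fin n => ν) := by
  have hmp := (measurePreserving_piFinSuccAbove (fun _ : Fin (n + 1) => ν) 0).symm
  have he : ∀ p : α × (Fin n → α),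
      (MeasurableEquiv.piFinSuccAbove (fun _ : Fin (n + 1) => α) 0).symm p =
        Fin.cons p.1 p.2 := by
    intro p
    simp [MeasurableEquiv.piFinSuccAbove, Fin.insertNthEquiv]
  rw [← hmp.integral_comp' F, integral_prod_symm]
  · simp only [he]
  · exact hmp.integrable_comp_of_integrable hF

/-- McDiarmid's method: the exponential moments of a function with bounded differences are
controlled one coordinate at a time by Hoeffding's lemma. -/
theorem integral_exp_le_of_bounded_differences {c C : ℝ} (n : ℕ) :
    ∀ F : (Fin n → α) → ℝ, Measurable F → (∀ z, |F z| ≤ C) →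
      (∀ i z a, |F (Function.update z i a) - F z| ≤ c) → ∀ t : ℝ,
      ∫ z, Real.exp (t * (F z - ∫ w, F w ∂(Measure.pi fun _ => ν))) ∂(Measure.pi fun _ => ν) ≤
        Real.exp (n * c ^ 2 * t ^ 2 / 2) := by
  have hne : Nonempty α := nonempty_of_isProbabilityMeasure ν
  induction n with
  | zero =>
    intro F _ _ _ t
    have : ∀ z : Fin 0 → α, F z = F default := fun z => by rw [Subsingleton.elim z default]
    simp [this]
  | succ n ih =>
    intro F hF hC hd t
    have hcons : Measurable fun p : α × (Fin n → α) => (Fin.cons p.1 p.2 : Fin (n + 1) → α) := by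
      refine measurable_pi_iff.2 fun i => ?_
      refine Fin.cases ?_ (fun j => ?_) i
      · simpa using measurable_fst
      · simpa using (by fun_prop : Measurable fun x : α × (Fin n → α) => x.2 j)
    have hFz : ∀ z', Measurable fun a => F (Fin.cons a z') := fun z' =>
      (hF.comp hcons).comp measurable_prodMk_right
    have hint : ∀ z', Integrable (fun a => F (Fin.cons a z')) ν := fun z' =>
      Integrable.of_bound (hFz z').aestronglyMeasurable C (ae_of_all _ fun a => hC _)
    set G : (Fin n → α) → ℝ := fun z' => ∫ a, F (Fin.cons a z') ∂ν with hG
    have hGm : Measurable G :=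
      ((hF.comp hcons).stronglyMeasurable.integral_prod_left' (μ := ν)).measurable
    have hGC : ∀ z', |G z'| ≤ C := fun z' => by
      simpa using norm_integral_le_of_norm_le_const (μ := ν) (C := C)
        (f := fun a => F (Fin.cons a z')) (ae_of_all _ fun a => hC _)
    have hGd : ∀ i z' a, |G (Function.update z' i a) - G z'| ≤ c := by
      intro i z' a
      rw [hG]
      simp only
      rw [← integral_sub (hint _) (hint _)]
      have := norm_integral_le_of_norm_le_const (μ := ν) (C := c)
        (f := fun x => F (Fin.cons x (Function.update z' i a)) - F (Fin.cons x z'))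
        (ae_of_all _ fun x => by
          rw [Fin.cons_update, Real.norm_eq_abs]
          exact hd _ _ _)
      simpa using this
    have hFi : Integrable F (Measure.pi fun _ => ν) :=
      Integrable.of_bound hF.aestronglyMeasurable C (ae_of_all _ fun a => hC _)
    have hEF : ∫ w, F w ∂(Measure.pi fun _ => ν) = ∫ w, G w ∂(Measure.pi fun _ => ν) :=
      integral_pi_succ ν F hFi
    rw [hEF]
    set e := ∫ w, G w ∂(Measure.pi fun _ : Fin n => ν) with he
    have hexpb : ∀ u : ℝ, |u| ≤ C → |Real.exp (t * (u - e))| ≤ Real.exp (|t| * (C + |e|)) := by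
      intro u hu
      rw [abs_of_pos (Real.exp_pos _)]
      refine Real.exp_le_exp.2 ((le_abs_self _).trans ?_)
      rw [abs_mul]
      gcongr
      exact (abs_sub _ _).trans (by gcongr)
    rw [integral_pi_succ ν (fun z => Real.exp (t * (F z - e)))]
    swap
    · exact Integrable.of_bound (by fun_prop) _ (ae_of_all _ fun a => hexpb _ (hC a))
    have hinner : ∀ z', ∫ a, Real.exp (t * (F (Fin.cons a z') - e)) ∂ν ≤
        Real.exp (t * (G z' - e)) * Real.exp (c ^ 2 * t ^ 2 / 2) := by
      intro z'
      obtain ⟨a₀⟩ := hne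
      have hH := hasSubgaussianMGF_of_mem_Icc (μ := ν) (X := fun a => F (Fin.cons a z'))
        (a := F (Fin.cons a₀ z') - c) (b := F (Fin.cons a₀ z') + c) (hFz z').aemeasurable
        (ae_of_all _ fun a => by
          have := hd 0 (Fin.cons a₀ z') a
          rw [Fin.update_cons_zero, abs_le] at this
          constructor <;> linarith)
      have hm := hH.mgf_le t
      rw [mgf] at hm
      have hs : ∀ a, Real.exp (t * (F (Fin.cons a z') - e)) =
          Real.exp (t * (G z' - e)) * Real.exp (t * (F (Fin.cons a z') - G z')) := by
        intro a
        rw [← Real.exp_add]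
        congr 1; ring
      simp_rw [hs]
      rw [integral_const_mul]
      gcongr
      refine hm.trans_eq ?_
      congr 2
      push_cast
      rw [Real.norm_eq_abs, div_pow, sq_abs]
      ring
    calc _ ≤ ∫ z', Real.exp (t * (G z' - e)) * Real.exp (c ^ 2 * t ^ 2 / 2)
          ∂(Measure.pi fun _ => ν) := by
          refine integral_mono_of_nonneg (ae_of_all _ fun z' => ?_) ?_ (ae_of_all _ hinner)
          · exact integral_nonneg fun a => (Real.exp_pos _).le
          · refine Integrable.mul_const ?_ _
            exact Integrable.of_bound (by fun_prop) _ (ae_of_all _ fun a => hexpb _ (hGC a))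
      _ = (∫ z', Real.exp (t * (G z' - e)) ∂(Measure.pi fun _ => ν)) *
          Real.exp (c ^ 2 * t ^ 2 / 2) := integral_mul_const _ _
      _ ≤ Real.exp (n * c ^ 2 * t ^ 2 / 2) * Real.exp (c ^ 2 * t ^ 2 / 2) := by
          gcongr
          exact ih G hGm hGC hGd t
      _ = _ := by
          rw [← Real.exp_add]
          congr 1
          push_cast
          ring

/-- McDiarmid's inequality (with a non-optimal constant). -/
theorem measureReal_ge_le_of_bounded_differences {c C : ℝ} {n : ℕ}
    {F : (Fin n → α) → ℝ} (hF : Measurable F) (hC : ∀ z, |F z| ≤ C)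
    (hd : ∀ i z a, |F (Function.update z i a) - F z| ≤ c) {ε : ℝ} (hε : 0 ≤ ε) :
    (Measure.pi fun _ => ν).real {z | ε ≤ F z - ∫ w, F w ∂(Measure.pi fun _ => ν)} ≤
      Real.exp (-ε ^ 2 / (2 * (n * c ^ 2))) := by
  set e := ∫ w, F w ∂(Measure.pi fun _ => ν)
  have h : HasSubgaussianMGF (fun z => F z - e) (Real.toNNReal (n * c ^ 2))
      (Measure.pi fun _ => ν) := by
    refine ⟨fun t => ?_, fun t => ?_⟩
    · refine Integrable.of_bound (by fun_prop) (Real.exp (|t| * (C + |e|)))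
        (ae_of_all _ fun z => ?_)
      rw [Real.norm_eq_abs, abs_of_pos (Real.exp_pos _)]
      refine Real.exp_le_exp.2 ((le_abs_self _).trans ?_)
      rw [abs_mul]
      gcongr
      exact (abs_sub _ _).trans (by gcongr; exact hC z)
    · rw [Real.coe_toNNReal _ (by positivity)]
      exact integral_exp_le_of_bounded_differences ν n F hF hC hd t
  have := h.measure_ge_le hε
  rwa [Real.coe_toNNReal _ (by positivity)] at this

end BoundedDifferences

/-! ### Exponential consistency of normalised kernel sums -/

section Consistency

open Metric ENNReal

variable {E : Type*} [NormedAddCommGroup E] [MeasurableSpace E] [NormedSpace ℝ E]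
  {β : Type*} [MeasurableSpace β]

/-- The kernel sum `n⁻¹ ∑ a(Zᵢ) K((x - Xᵢ) / h) / E K((x - X) / h)` with deterministic
normalisation, for data `Zᵢ = (Xᵢ, ·)`. -/
noncomputable def normalizedSum (μ : Measure E) (K : E → ℝ) (h : ℝ) (a : E × β → ℝ) {n : ℕ}
    (D : Fin n → E × β) (x : E) : ℝ :=
  (n : ℝ)⁻¹ * ∑ i, a (D i) * weight μ K h x (D i).1

/-- The `L¹(μ)` distance of the normalised kernel sum to `m`. -/
noncomputable def l1Error (μ : Measure E) (K : E → ℝ) (h : ℝ) (a : E × β → ℝ) (m : E → ℝ) {n : ℕ}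
    (D : Fin n → E × β) : ℝ :=
  ∫ x, |normalizedSum μ K h a D x - m x| ∂μ

variable [BorelSpace E] [FiniteDimensional ℝ E]

lemma measurable_normalizedSum {μ : Measure E} [IsProbabilityMeasure μ] {K : E → ℝ}
    (hK : Measurable K) (h : ℝ) {a : E × β → ℝ} (ha : Measurable a) (n : ℕ) :
    Measurable fun p : (Fin n → E × β) × E => normalizedSum μ K h a p.1 p.2 := by
  refine measurable_const.mul (Finset.measurable_sum _ fun i _ => ?_)
  have h1 : Measurable fun p : (Fin n → E × β) × E => p.1 i := by fun_prop
  exact (ha.comp h1).mul ((measurable_weight hK h).comp (measurable_snd.prodMk h1.fst))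

lemma measurable_l1Error {μ : Measure E} [IsProbabilityMeasure μ] {K : E → ℝ}
    (hK : Measurable K) (h : ℝ) {a : E × β → ℝ} (ha : Measurable a) {m : E → ℝ}
    (hm : Measurable m) (n : ℕ) :
    Measurable fun D : Fin n → E × β => l1Error μ K h a m D := by
  have : Measurable fun p : (Fin n → E × β) × E => |normalizedSum μ K h a p.1 p.2 - m p.2| :=
    ((measurable_normalizedSum hK h ha n).sub (hm.comp measurable_snd)).abs
  exact (this.stronglyMeasurable.integral_prod_right' (ν := μ)).measurable

namespace RegularKernel

variable {μ ρ : Measure E} [IsProbabilityMeasure μ] [ρ.IsAddHaarMeasure] {K : E → ℝ} {b r : ℝ}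

lemma exists_integral_weight_le (hK : RegularKernel ρ K b r) :
    ∃ c : ℝ, 0 < c ∧ ∀ h : ℝ, 0 < h → ∀ z, Integrable (fun x => weight μ K h x z) μ ∧
      ∫ x, weight μ K h x z ∂μ ≤ c := by
  obtain ⟨c, hc0, hc⟩ := hK.exists_lintegral_weight_le (μ := μ)
  refine ⟨c, hc0, fun h hh z => ?_⟩
  have hm : Measurable fun x => weight μ K h x z :=
    (measurable_weight hK.measurable h).comp measurable_prodMk_right
  have h0 : 0 ≤ᵐ[μ] fun x => weight μ K h x z := ae_of_all _ fun x => weight_nonneg hK.nonneg h x z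
  refine ⟨⟨hm.aestronglyMeasurable, ?_⟩, ?_⟩
  · rw [hasFiniteIntegral_iff_ofReal h0]
    exact (hc h hh z).trans_lt ENNReal.ofReal_lt_top
  · rw [integral_eq_lintegral_of_nonneg_ae h0 hm.aestronglyMeasurable]
    exact ENNReal.toReal_le_of_le_ofReal hc0.le (hc h hh z)

lemma integrable_normalizedSum {β : Type*} (hK : RegularKernel ρ K b r) {h : ℝ} (hh : 0 < h)
    (a : E × β → ℝ) {n : ℕ} (D : Fin n → E × β) : Integrable (normalizedSum μ K h a D) μ := by
  obtain ⟨c, -, hc⟩ := hK.exists_integral_weight_le (μ := μ)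
  exact (integrable_finsetSum _ fun i _ => (hc h hh (D i).1).1.const_mul _).const_mul _

/-- Changing one observation changes the `L¹` error by `O(1 / n)`, uniformly in the bandwidth. -/
lemma exists_l1Error_bounded_differences {β : Type*} (hK : RegularKernel ρ K b r)
    {a : E × β → ℝ} {A : ℝ}
    (hA0 : 0 ≤ A) (hA : ∀ z, |a z| ≤ A) {m : E → ℝ} (hm : Integrable m μ) :
    ∃ c : ℝ, 0 < c ∧ ∀ h : ℝ, 0 < h → ∀ (n : ℕ) (D : Fin n → E × β),
      l1Error μ K h a m D ≤ A * c + ∫ x, |m x| ∂μ ∧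
      ∀ i z, |l1Error μ K h a m (Function.update D i z) - l1Error μ K h a m D| ≤
        (n : ℝ)⁻¹ * (2 * A * c) := by
  obtain ⟨c, hc0, hc⟩ := hK.exists_integral_weight_le (μ := μ)
  refine ⟨c, hc0, fun h hh n D => ?_⟩
  have hN : ∀ D : Fin n → E × β, Integrable (normalizedSum μ K h a D) μ :=
    hK.integrable_normalizedSum hh a
  have hterm : ∀ z : E × β, ∀ x, |a z * weight μ K h x z.1| ≤ A * weight μ K h x z.1 := by
    intro z x
    rw [abs_mul, abs_of_nonneg (weight_nonneg hK.nonneg h x z.1)]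
    exact mul_le_mul_of_nonneg_right (hA z) (weight_nonneg hK.nonneg h x z.1)
  constructor
  · have h1 : ∀ x, |normalizedSum μ K h a D x - m x| ≤
        (n : ℝ)⁻¹ * ∑ i, A * weight μ K h x (D i).1 + |m x| := by
      intro x
      refine (abs_sub _ _).trans ?_
      gcongr
      rw [normalizedSum, abs_mul, abs_of_nonneg (by positivity : (0 : ℝ) ≤ (n : ℝ)⁻¹)]
      gcongr
      exact (Finset.abs_sum_le_sum_abs _ _).trans (Finset.sum_le_sum fun i _ => hterm _ _)
    have h2 : Integrable (fun x => (n : ℝ)⁻¹ * ∑ i, A * weight μ K h x (D i).1) μ :=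
      (integrable_finsetSum _ fun i _ => (hc h hh (D i).1).1.const_mul _).const_mul _
    calc l1Error μ K h a m D
        ≤ ∫ x, ((n : ℝ)⁻¹ * ∑ i, A * weight μ K h x (D i).1 + |m x|) ∂μ :=
          integral_mono ((hN D).sub hm).abs (h2.add hm.abs) h1
      _ = (n : ℝ)⁻¹ * ∑ i, A * ∫ x, weight μ K h x (D i).1 ∂μ + ∫ x, |m x| ∂μ := by
          rw [integral_add h2 hm.abs, integral_const_mul, integral_finsetSum]
          · simp_rw [integral_const_mul]
          · exact fun i _ => (hc h hh (D i).1).1.const_mul _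
      _ ≤ A * c + ∫ x, |m x| ∂μ := by
          refine add_le_add_left ?_ _
          calc _ ≤ (n : ℝ)⁻¹ * ∑ _i : Fin n, A * c := by
                gcongr with i
                exact (hc h hh _).2
            _ = (n : ℝ)⁻¹ * n * (A * c) := by simp [mul_assoc]
            _ ≤ 1 * (A * c) := by
                gcongr
                exact inv_mul_le_one
            _ = A * c := one_mul _
  · intro i z
    have hdiff : ∀ x, normalizedSum μ K h a (Function.update D i z) x - normalizedSum μ K h a D x =
        (n : ℝ)⁻¹ * (a z * weight μ K h x z.1 - a (D i) * weight μ K h x (D i).1) := by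
      intro x
      simp only [normalizedSum]
      rw [← mul_sub, ← Finset.sum_sub_distrib, Finset.sum_eq_single i]
      · simp
      · intro j _ hj
        simp [Function.update_of_ne hj]
      · simp
    have hI : Integrable (fun x => (n : ℝ)⁻¹ * (A * weight μ K h x z.1 +
        A * weight μ K h x (D i).1)) μ :=
      (((hc h hh z.1).1.const_mul A).add ((hc h hh (D i).1).1.const_mul A)).const_mul _
    rw [l1Error, l1Error, ← integral_sub
      (f := fun x => |normalizedSum μ K h a (Function.update D i z) x - m x|)
      (g := fun x => |normalizedSum μ K h a D x - m x|) ((hN _).sub hm).abs ((hN _).sub hm).abs]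
    refine abs_integral_le_integral_abs.trans ?_
    calc _ ≤ ∫ x, (n : ℝ)⁻¹ * (A * weight μ K h x z.1 + A * weight μ K h x (D i).1) ∂μ := by
          refine integral_mono (((hN _).sub hm).abs.sub ((hN _).sub hm).abs).abs hI fun x => ?_
          refine (abs_abs_sub_abs_le _ _).trans ?_
          rw [sub_sub_sub_cancel_right, hdiff, abs_mul,
            abs_of_nonneg (by positivity : (0 : ℝ) ≤ (n : ℝ)⁻¹)]
          gcongr
          exact (abs_sub _ _).trans (add_le_add (hterm _ _) (hterm _ _))
      _ = (n : ℝ)⁻¹ * (A * ∫ x, weight μ K h x z.1 ∂μ + A * ∫ x, weight μ K h x (D i).1 ∂μ) := by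
          rw [integral_const_mul, integral_add ((hc h hh z.1).1.const_mul A)
            ((hc h hh (D i).1).1.const_mul A), integral_const_mul, integral_const_mul]
      _ ≤ _ := by
          gcongr
          have h1 := mul_le_mul_of_nonneg_left (hc h hh z.1).2 hA0
          have h2 := mul_le_mul_of_nonneg_left (hc h hh (D i).1).2 hA0
          linarith

end RegularKernel

/-- For `x` with positive kernel mass, the mean absolute deviation of the normalised kernel sum
from its expectation is bounded by `2 A`, and by half of `η` plus the variance over `2 η`. -/
lemma integral_abs_normalizedSum_sub_le {μ : Measure E} [IsProbabilityMeasure μ] {K : E → ℝ}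
    (hKm : Measurable K) (hK0 : ∀ u, 0 ≤ K u) {C : ℝ} (hKC : ∀ u, K u ≤ C)
    (ν : Measure (E × β)) [IsProbabilityMeasure ν] (hμ : ν.map Prod.fst = μ)
    {a : E × β → ℝ} (ha : Measurable a) {A : ℝ} (hA : ∀ z, |a z| ≤ A) {h : ℝ} {x : E}
    (hx : 0 < kernelMass μ K h x) {n : ℕ} (hn : 0 < n) {η : ℝ} (hη : 0 < η) :
    Integrable (fun D : Fin n → E × β => normalizedSum μ K h a D x) (Measure.pi fun _ => ν) ∧
    ∫ D, |normalizedSum μ K h a D x - ∫ z, a z * weight μ K h x z.1 ∂ν|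
      ∂(Measure.pi fun _ : Fin n => ν) ≤
        min (2 * A) (η / 2 + A ^ 2 * C / (2 * η * n) / kernelMass μ K h x) := by
  have hn' : (0 : ℝ) < n := by exact_mod_cast hn
  have hA0 : 0 ≤ A := by
    obtain ⟨z⟩ := nonempty_of_isProbabilityMeasure ν
    exact (abs_nonneg _).trans (hA z)
  have hC0 : 0 ≤ C := (hK0 0).trans (hKC 0)
  set s := kernelMass μ K h x with hs
  set f : E × β → ℝ := fun z => a z * weight μ K h x z.1 with hf
  have hwm : Measurable (weight μ K h x) := (measurable_weight hKm h).comp measurable_prodMk_left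
  have hfm : Measurable f := ha.mul (hwm.comp measurable_fst)
  have hw0 : ∀ z, 0 ≤ weight μ K h x z := weight_nonneg hK0 h x
  have hwC : ∀ z, weight μ K h x z ≤ C / s := fun z => div_le_div_of_nonneg_right (hKC _) hx.le
  have hfw : ∀ z, |f z| ≤ A * weight μ K h x z.1 := fun z => by
    rw [hf, abs_mul, abs_of_nonneg (hw0 _)]
    exact mul_le_mul_of_nonneg_right (hA z) (hw0 _)
  have hfb : ∀ z, |f z| ≤ A * (C / s) := fun z =>
    (hfw z).trans (mul_le_mul_of_nonneg_left (hwC _) hA0)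
  have hwi : Integrable (fun z : E × β => weight μ K h x z.1) ν :=
    Integrable.of_bound (hwm.comp measurable_fst).aestronglyMeasurable (C / s)
      (ae_of_all _ fun z => by rw [Real.norm_of_nonneg (hw0 _)]; exact hwC _)
  have hw1 : ∫ z, weight μ K h x z.1 ∂ν = 1 := by
    rw [← integral_weight hx, ← hμ, integral_map measurable_fst.aemeasurable
      (by rw [hμ]; exact hwm.aestronglyMeasurable)]
  have hfL : MemLp f 2 ν := MemLp.of_bound hfm.aestronglyMeasurable _ (ae_of_all _ hfb)
  have hfi : Integrable f ν := hfL.integrable one_le_two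
  have habs : ∫ z, |f z| ∂ν ≤ A := by
    calc _ ≤ ∫ z, A * weight μ K h x z.1 ∂ν := integral_mono hfi.abs (hwi.const_mul A) hfw
      _ = A := by rw [integral_const_mul, hw1, mul_one]
  have hsq : ∫ z, f z ^ 2 ∂ν ≤ A ^ 2 * (C / s) := by
    calc _ ≤ ∫ z, A ^ 2 * (C / s) * weight μ K h x z.1 ∂ν := by
          refine integral_mono hfL.integrable_sq (hwi.const_mul _) fun z => ?_
          calc f z ^ 2 = |f z| * |f z| := by rw [← sq, sq_abs]
            _ ≤ (A * (C / s)) * (A * weight μ K h x z.1) :=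
              mul_le_mul (hfb z) (hfw z) (abs_nonneg _) (by positivity)
            _ = _ := by ring
      _ = _ := by rw [integral_const_mul, hw1, mul_one]
  set π := Measure.pi fun _ : Fin n => ν with hπ
  have hmp : ∀ i, MeasurePreserving (fun D : Fin n → E × β => D i) π ν := fun i =>
    measurePreserving_eval (fun _ => ν) i
  have hcomp : ∀ g : E × β → ℝ, Measurable g → ∀ i, ∫ D, g (D i) ∂π = ∫ z, g z ∂ν := by
    intro g hg i
    conv_rhs => rw [← (hmp i).map_eq]
    rw [integral_map (hmp i).measurable.aemeasurable hg.aestronglyMeasurable]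
  set S : (Fin n → E × β) → ℝ := fun D => normalizedSum μ K h a D x with hS
  have hSeq : S = fun D => (n : ℝ)⁻¹ * ∑ i, f (D i) := rfl
  have hfDi : ∀ i, Integrable (fun D : Fin n → E × β => f (D i)) π := fun i =>
    (hmp i).integrable_comp_of_integrable hfi
  have hfDL : ∀ i, MemLp (fun D : Fin n → E × β => f (D i)) 2 π := fun i =>
    hfL.comp_measurePreserving (hmp i)
  have hSL : MemLp S 2 π := (memLp_finsetSum _ fun i _ => hfDL i).const_mul _
  have hSi : Integrable S π := hSL.integrable one_le_two
  have hES : ∫ D, S D ∂π = ∫ z, f z ∂ν := by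
    rw [hSeq, integral_const_mul, integral_finsetSum _ fun i _ => hfDi i]
    simp only [hcomp f hfm, Finset.sum_const, Finset.card_univ, Fintype.card_fin, nsmul_eq_mul]
    rw [inv_mul_cancel_left₀ hn'.ne']
  have hVar : Var[S; π] ≤ A ^ 2 * C / n / s := by
    have h1 : Var[∑ i, fun D : Fin n → E × β => f (D i); π] = ∑ _i : Fin n, Var[f; ν] :=
      variance_sum_pi (μ := fun _ => ν) (X := fun _ => f) fun _ => hfL
    have h2 : S = fun D => (n : ℝ)⁻¹ * (∑ i, fun D : Fin n → E × β => f (D i)) D := by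
      rw [hSeq]; funext D; simp
    rw [h2, variance_const_mul, h1]
    have h3 : Var[f; ν] ≤ A ^ 2 * (C / s) :=
      (variance_le_expectation_sq hfm.aestronglyMeasurable).trans hsq
    simp only [Finset.sum_const, Finset.card_univ, Fintype.card_fin, nsmul_eq_mul]
    calc (n : ℝ)⁻¹ ^ 2 * (n * Var[f; ν]) ≤ (n : ℝ)⁻¹ ^ 2 * (n * (A ^ 2 * (C / s))) := by gcongr
      _ = _ := by field_simp
  refine ⟨hSi, le_min ?_ ?_⟩
  · have hEabs : ∫ D, |S D| ∂π ≤ A := by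
      have hb : ∀ D, |S D| ≤ (n : ℝ)⁻¹ * ∑ i, |f (D i)| := fun D => by
        rw [hSeq]
        simp only
        rw [abs_mul, abs_of_pos (inv_pos.2 hn')]
        gcongr
        exact Finset.abs_sum_le_sum_abs _ _
      calc _ ≤ ∫ D, (n : ℝ)⁻¹ * ∑ i, |f (D i)| ∂π := integral_mono hSi.abs
            ((integrable_finsetSum _ fun i _ => (hfDi i).abs).const_mul _) hb
        _ = (n : ℝ)⁻¹ * ∑ _i : Fin n, ∫ z, |f z| ∂ν := by
            rw [integral_const_mul, integral_finsetSum _ fun i _ => (hfDi i).abs]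
            congr 1
            refine Finset.sum_congr rfl fun i _ => ?_
            exact hcomp (fun z => |f z|) hfm.abs i
        _ = ∫ z, |f z| ∂ν := by
            simp only [Finset.sum_const, Finset.card_univ, Fintype.card_fin, nsmul_eq_mul]
            rw [inv_mul_cancel_left₀ hn'.ne']
        _ ≤ A := habs
    calc _ ≤ ∫ D, (|S D| + A) ∂π := by
          refine integral_mono (hSi.sub (integrable_const _)).abs
            (hSi.abs.add (integrable_const _)) fun D => (abs_sub _ _).trans ?_
          gcongr
          exact abs_integral_le_integral_abs.trans habs
      _ ≤ 2 * A := by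
          rw [integral_add hSi.abs (integrable_const _)]
          simp
          linarith
  · have hI : Integrable (fun D => (S D - ∫ z, f z ∂ν) ^ 2) π :=
      (hSL.sub (memLp_const _)).integrable_sq
    calc _ ≤ ∫ D, (η / 2 + (S D - ∫ z, f z ∂ν) ^ 2 / (2 * η)) ∂π := by
          refine integral_mono (hSi.sub (integrable_const _)).abs
            ((integrable_const _).add (hI.div_const _)) fun D => ?_
          -- the arithmetic-geometric mean inequality
          have h1 := two_mul_le_add_sq η |S D - ∫ z, f z ∂ν|
          rw [sq_abs] at h1
          have h2 : η / 2 + (S D - ∫ z, f z ∂ν) ^ 2 / (2 * η) =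
            (η ^ 2 + (S D - ∫ z, f z ∂ν) ^ 2) / (2 * η) := by field_simp
          simp only
          rw [h2, le_div_iff₀ (by positivity)]
          linarith
      _ = η / 2 + Var[S; π] / (2 * η) := by
          rw [integral_add (integrable_const _) (hI.div_const _),
            variance_eq_integral hSi.aemeasurable, hES]
          simp [integral_div]
      _ ≤ η / 2 + A ^ 2 * C / n / s / (2 * η) := by gcongr
      _ = _ := by field_simp

/-- `m` is a version of the regression function `E[a(Z) | X = ·]` for `Z = (X, ·)` with law `ν`:
it has the same integrals as `a` against bounded functions of the first coordinate. -/
structure IsRegression (ν : Measure (E × β)) (a : E × β → ℝ) (m : E → ℝ) : Prop where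
  measurable : Measurable m
  integrable : Integrable m (ν.map Prod.fst)
  integral_mul_eq : ∀ φ : E → ℝ, Measurable φ → ∀ C : ℝ, (∀ x, |φ x| ≤ C) →
    ∫ z, a z * φ z.1 ∂ν = ∫ x, m x * φ x ∂(ν.map Prod.fst)

namespace RegularKernel

variable {μ ρ : Measure E} [IsProbabilityMeasure μ] [ρ.IsAddHaarMeasure] {K : E → ℝ} {b r : ℝ}

/-- The pointwise bias is dominated by the weighted mean oscillation of the regression function. -/
lemma enorm_integral_mul_weight_sub_le (hK : RegularKernel ρ K b r) {ν : Measure (E × β)}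
    (hμ : ν.map Prod.fst = μ) {a : E × β → ℝ} {m : E → ℝ} (hm : IsRegression ν a m) {h : ℝ}
    {x : E} (hx : 0 < kernelMass μ K h x) :
    ‖∫ z, a z * weight μ K h x z.1 ∂ν - m x‖ₑ ≤
      ∫⁻ z, ENNReal.ofReal (weight μ K h x z) * ‖m z - m x‖ₑ ∂μ := by
  obtain ⟨C, -, hC⟩ := hK.exists_bound
  have hwm : Measurable (weight μ K h x) :=
    (measurable_weight hK.measurable h).comp measurable_prodMk_left
  have hw0 : ∀ z, 0 ≤ weight μ K h x z := weight_nonneg hK.nonneg h x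
  have hwC : ∀ z, |weight μ K h x z| ≤ C / kernelMass μ K h x := fun z => by
    rw [abs_of_nonneg (hw0 z)]
    exact div_le_div_of_nonneg_right (hC _) hx.le
  have hmi : Integrable m μ := hμ ▸ hm.integrable
  have hmw : Integrable (fun z => m z * weight μ K h x z) μ :=
    hmi.mul_bdd (c := C / kernelMass μ K h x) hwm.aestronglyMeasurable (ae_of_all _ hwC)
  rw [hm.integral_mul_eq _ hwm _ hwC, hμ]
  have : ∫ z, m z * weight μ K h x z ∂μ - m x = ∫ z, weight μ K h x z * (m z - m x) ∂μ := by
    calc _ = ∫ z, m z * weight μ K h x z ∂μ - ∫ z, weight μ K h x z * m x ∂μ := by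
          rw [integral_mul_const, integral_weight hx, one_mul]
      _ = _ := by
          rw [← integral_sub hmw ((hK.integrable_weight h x).mul_const _)]
          congr 1; funext z; ring
  rw [this]
  refine (enorm_integral_le_lintegral_enorm _).trans_eq ?_
  refine lintegral_congr fun z => ?_
  rw [enorm_mul, Real.enorm_of_nonneg (hw0 z)]

/-- The expected `L¹` distance between the normalised kernel sum and the regression function
vanishes. The variance at `x` is of order `1 / (n μ(B(x, r h)))`, which integrates to
`O(1 / (n hᵈ))` over bounded sets. -/
lemma tendsto_lintegral_normalizedSum_sub (hK : RegularKernel ρ K b r) {h : ℕ → ℝ}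
    (hpos : ∀ n, 0 < h n) (hh : Tendsto h atTop (𝓝 0))
    (hnh : Tendsto (fun n : ℕ => (n : ℝ) * h n ^ Module.finrank ℝ E) atTop atTop)
    {ν : Measure (E × β)} [IsProbabilityMeasure ν]
    (hμ : ν.map Prod.fst = μ) {a : E × β → ℝ} (ha : Measurable a) {A : ℝ} (hA : ∀ z, |a z| ≤ A)
    {m : E → ℝ} (hm : IsRegression ν a m) :
    Tendsto (fun n : ℕ => ∫⁻ D, ∫⁻ x, ‖normalizedSum μ K (h n) a D x - m x‖ₑ ∂μ
      ∂(Measure.pi fun _ : Fin n => ν)) atTop (𝓝 0) := by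
  have hmi : Integrable m μ := hμ ▸ hm.integrable
  have hA0 : 0 ≤ A := by
    obtain ⟨z⟩ := nonempty_of_isProbabilityMeasure ν
    exact (abs_nonneg _).trans (hA z)
  obtain ⟨C, hC0, hC⟩ := hK.exists_bound
  rw [ENNReal.tendsto_nhds_zero]
  intro ε hε
  obtain ⟨η, hη0, hηε⟩ : ∃ η : ℝ, 0 < η ∧ ENNReal.ofReal (4 * η) ≤ ε := by
    rcases eq_or_ne ε ⊤ with rfl | hεt
    · exact ⟨1, one_pos, le_top⟩
    · refine ⟨ε.toReal / 4, div_pos (ENNReal.toReal_pos hε.ne' hεt) (by positivity), ?_⟩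
      rw [mul_div_cancel₀ _ (by positivity), ENNReal.ofReal_toReal hεt]
  have hηpos : 0 < ENNReal.ofReal η := ENNReal.ofReal_pos.2 hη0
  -- a large ball carrying almost all of `μ`
  obtain ⟨R, hR⟩ : ∃ R : ℝ, ENNReal.ofReal (2 * A) * μ (ball 0 R)ᶜ ≤ ENNReal.ofReal η := by
    have h1 : Tendsto (fun j : ℕ => μ (ball (0 : E) j)ᶜ) atTop (𝓝 (μ (⋂ j : ℕ, (ball 0 j)ᶜ))) := by
      refine tendsto_measure_iInter_atTop
        (fun j => measurableSet_ball.compl.nullMeasurableSet) ?_ ⟨0, measure_ne_top _ _⟩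
      intro i j hij
      exact Set.compl_subset_compl.2 (ball_subset_ball (by exact_mod_cast hij))
    rw [← Set.compl_iUnion, iUnion_ball_nat, Set.compl_univ, measure_empty] at h1
    have h2 := ENNReal.Tendsto.const_mul h1 (a := ENNReal.ofReal (2 * A))
      (Or.inr ENNReal.ofReal_ne_top)
    rw [mul_zero] at h2
    obtain ⟨j, hj⟩ := ((ENNReal.tendsto_nhds_zero.1 h2) _ hηpos).exists
    exact ⟨j, hj⟩
  set Q : ℝ := A ^ 2 * C / (2 * η) with hQ
  have hQ0 : 0 ≤ Q := by positivity
  set c := (ENNReal.ofReal b)⁻¹ * ((ρ (ball 0 (r / 2)))⁻¹ * ρ (ball 0 (R + r / 2))) with hc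
  have hb0 : ENNReal.ofReal b ≠ 0 := (ENNReal.ofReal_pos.2 hK.b_pos).ne'
  have hct : c ≠ ⊤ := ENNReal.mul_ne_top (ENNReal.inv_ne_top.2 hb0) (ENNReal.mul_ne_top
    (ENNReal.inv_ne_top.2 (measure_ball_pos ρ 0 (half_pos hK.r_pos)).ne') measure_ball_lt_top.ne)
  have hvar : Tendsto (fun n : ℕ => ENNReal.ofReal (Q / (n * h n ^ Module.finrank ℝ E)) * c)
      atTop (𝓝 0) := by
    have h1 := ENNReal.tendsto_ofReal (hnh.const_div_atTop Q)
    rw [ENNReal.ofReal_zero] at h1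
    simpa using ENNReal.Tendsto.mul_const h1 (Or.inr hct)
  filter_upwards [ENNReal.tendsto_nhds_zero.1 hvar _ hηpos,
    ENNReal.tendsto_nhds_zero.1 (hK.tendsto_bias hpos hh hm.measurable hmi) _ hηpos,
    eventually_gt_atTop 0, hh.eventually_le_const one_pos] with n hn1 hn2 hn hn3
  have hn' : (0 : ℝ) < n := by exact_mod_cast hn
  have hNm : Measurable fun p : (Fin n → E × β) × E =>
      ‖normalizedSum μ K (h n) a p.1 p.2 - m p.2‖ₑ :=
    ((measurable_normalizedSum hK.measurable _ ha n).sub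
      (hm.measurable.comp measurable_snd)).enorm
  rw [lintegral_lintegral_swap hNm.aemeasurable]
  have hpt : ∀ᵐ x ∂μ, ∫⁻ D, ‖normalizedSum μ K (h n) a D x - m x‖ₑ
        ∂(Measure.pi fun _ : Fin n => ν) ≤
      ((ball (0 : E) R).indicator (fun x => ENNReal.ofReal η +
        ENNReal.ofReal (Q / n) * (ENNReal.ofReal b)⁻¹ * (μ (ball x (r * h n)))⁻¹) x +
      (ball (0 : E) R)ᶜ.indicator (fun _ => ENNReal.ofReal (2 * A)) x) +
      ∫⁻ z, ENNReal.ofReal (weight μ K (h n) x z) * ‖m z - m x‖ₑ ∂μ := by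
    filter_upwards [hK.ae_kernelMass_pos (μ := μ) (hpos n)] with x hx
    obtain ⟨hi, hle⟩ := integral_abs_normalizedSum_sub_le hK.measurable hK.nonneg hC ν hμ ha hA hx
      hn hη0
    set t := ∫ z, a z * weight μ K (h n) x z.1 ∂ν with ht
    calc _ ≤ ∫⁻ D, (‖normalizedSum μ K (h n) a D x - t‖ₑ + ‖t - m x‖ₑ)
          ∂(Measure.pi fun _ : Fin n => ν) := by
          gcongr with D
          rw [← sub_add_sub_cancel _ t (m x)]
          exact enorm_add_le _ _
      _ = ∫⁻ D, ‖normalizedSum μ K (h n) a D x - t‖ₑ ∂(Measure.pi fun _ : Fin n => ν) +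
          ‖t - m x‖ₑ := by
          rw [lintegral_add_right _ measurable_const]
          simp
      _ ≤ _ := by
          refine add_le_add ?_ (hK.enorm_integral_mul_weight_sub_le hμ hm hx)
          have hint : Integrable (fun D : Fin n → E × β => normalizedSum μ K (h n) a D x - t)
            (Measure.pi fun _ : Fin n => ν) := hi.sub (integrable_const _)
          rw [← ofReal_integral_norm_eq_lintegral_enorm hint]
          by_cases hxR : x ∈ ball (0 : E) R
          · rw [Set.indicator_of_mem hxR, Set.indicator_of_notMem (by simpa using hxR), add_zero]
            calc _ ≤ ENNReal.ofReal (η + Q / n * (kernelMass μ K (h n) x)⁻¹) := by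
                  refine ENNReal.ofReal_le_ofReal (hle.trans ((min_le_right _ _).trans ?_))
                  have hQn : A ^ 2 * C / (2 * η * n) = Q / n := by rw [hQ, div_div]
                  rw [← div_eq_mul_inv, hQn]
                  gcongr
                  linarith
              _ = ENNReal.ofReal η +
                  ENNReal.ofReal (Q / n) * (ENNReal.ofReal (kernelMass μ K (h n) x))⁻¹ := by
                  rw [ENNReal.ofReal_add hη0.le (by positivity),
                    ENNReal.ofReal_mul (by positivity), ENNReal.ofReal_inv_of_pos hx]
              _ ≤ _ := by
                  rw [mul_assoc, ← ENNReal.mul_inv (Or.inl hb0) (Or.inl ENNReal.ofReal_ne_top)]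
                  gcongr
                  exact hK.measure_ball_le_kernelMass (hpos n) x
          · rw [Set.indicator_of_notMem hxR, Set.indicator_of_mem (by simpa using hxR), zero_add]
            exact ENNReal.ofReal_le_ofReal (hle.trans (min_le_left _ _))
  have hmeas : Measurable fun x => μ (ball x (r * h n)) := by
    have : MeasurableSet {p : E × E | dist p.2 p.1 < r * h n} :=
      (isOpen_lt (by fun_prop) continuous_const).measurableSet
    exact measurable_measure_prodMk_left this
  have hinv : Measurable fun x => (μ (ball x (r * h n)))⁻¹ := hmeas.inv
  have hm1 : Measurable fun x => ENNReal.ofReal η +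
        ENNReal.ofReal (Q / n) * (ENNReal.ofReal b)⁻¹ * (μ (ball x (r * h n)))⁻¹ :=
    (hinv.const_mul _).const_add _
  have hI1 : ∫⁻ x, (ball (0 : E) R).indicator (fun x => ENNReal.ofReal η +
        ENNReal.ofReal (Q / n) * (ENNReal.ofReal b)⁻¹ * (μ (ball x (r * h n)))⁻¹) x ∂μ ≤
      ENNReal.ofReal η + ENNReal.ofReal η := by
    rw [lintegral_indicator measurableSet_ball, lintegral_add_left measurable_const,
      lintegral_const_mul _ hinv, setLIntegral_const]
    refine add_le_add (mul_le_of_le_one_right' prob_le_one) (le_trans ?_ hn1)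
    have hp0 : ENNReal.ofReal (h n ^ Module.finrank ℝ E) ≠ 0 := by
      simpa using pow_pos (hpos n) _
    calc _ ≤ ENNReal.ofReal (Q / n) * (ENNReal.ofReal b)⁻¹ *
          ((ENNReal.ofReal (h n ^ Module.finrank ℝ E) * ρ (ball 0 (r / 2)))⁻¹ *
            ρ (ball 0 (R + r / 2))) := by
          gcongr
          refine (lintegral_inv_measure_ball_le μ ρ (hpos n) hK.r_pos).trans ?_
          gcongr
          have := hK.r_pos
          nlinarith
      _ = _ := by
          rw [ENNReal.mul_inv (Or.inl hp0) (Or.inl ENNReal.ofReal_ne_top), hc, ← div_div,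
            div_eq_mul_inv (Q / n), ENNReal.ofReal_mul (by positivity),
            ENNReal.ofReal_inv_of_pos (pow_pos (hpos n) _)]
          ring
  have hI2 : ∫⁻ x, (ball (0 : E) R)ᶜ.indicator (fun _ => ENNReal.ofReal (2 * A)) x ∂μ ≤
      ENNReal.ofReal η := by
    rw [lintegral_indicator measurableSet_ball.compl, setLIntegral_const]
    exact hR
  calc _ ≤ _ := lintegral_mono_ae hpt
    _ = (∫⁻ x, (ball (0 : E) R).indicator (fun x => ENNReal.ofReal η +
        ENNReal.ofReal (Q / n) * (ENNReal.ofReal b)⁻¹ * (μ (ball x (r * h n)))⁻¹) x ∂μ +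
        ∫⁻ x, (ball (0 : E) R)ᶜ.indicator (fun _ => ENNReal.ofReal (2 * A)) x ∂μ) +
        ∫⁻ x, ∫⁻ z, ENNReal.ofReal (weight μ K (h n) x z) * ‖m z - m x‖ₑ ∂μ ∂μ := by
        rw [lintegral_add_left, lintegral_add_left]
        · exact hm1.indicator measurableSet_ball
        · exact (hm1.indicator measurableSet_ball).add
            (measurable_const.indicator measurableSet_ball.compl)
    _ ≤ ((ENNReal.ofReal η + ENNReal.ofReal η) + ENNReal.ofReal η) + ENNReal.ofReal η :=
        add_le_add (add_le_add hI1 hI2) hn2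
    _ = ENNReal.ofReal (4 * η) := by
        rw [← ENNReal.ofReal_add hη0.le hη0.le, ← ENNReal.ofReal_add (by positivity) hη0.le,
          ← ENNReal.ofReal_add (by positivity) hη0.le]
        congr 1; ring
    _ ≤ ε := hηε

/-- Exponential `L¹` consistency of normalised kernel sums: the expected error vanishes, and by
the bounded differences inequality the error exceeds its mean only with exponentially small
probability. -/
theorem exists_measureReal_l1Error_le (hK : RegularKernel ρ K b r) {h : ℕ → ℝ}
    (hpos : ∀ n, 0 < h n) (hh : Tendsto h atTop (𝓝 0))
    (hnh : Tendsto (fun n : ℕ => (n : ℝ) * h n ^ Module.finrank ℝ E) atTop atTop)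
    {ν : Measure (E × β)} [IsProbabilityMeasure ν]
    (hμ : ν.map Prod.fst = μ) {a : E × β → ℝ} (ha : Measurable a) {A : ℝ} (hA : ∀ z, |a z| ≤ A)
    {m : E → ℝ} (hm : IsRegression ν a m) {ε : ℝ} (hε : 0 < ε) :
    ∃ c > 0, ∀ᶠ n : ℕ in atTop, (Measure.pi fun _ : Fin n => ν).real
      {D | ε ≤ l1Error μ K (h n) a m D} ≤ Real.exp (-c * n) := by
  have hmi : Integrable m μ := hμ ▸ hm.integrable
  have hA0 : 0 ≤ A := by
    obtain ⟨z⟩ := nonempty_of_isProbabilityMeasure ν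
    exact (abs_nonneg _).trans (hA z)
  have hA1 : ∀ z, |a z| ≤ A + 1 := fun z => (hA z).trans (by linarith)
  obtain ⟨c, hc0, hc⟩ := hK.exists_l1Error_bounded_differences (by positivity) hA1 hmi
  refine ⟨(ε / 2) ^ 2 / (2 * (2 * (A + 1) * c) ^ 2), by positivity, ?_⟩
  filter_upwards [eventually_gt_atTop 0, ENNReal.tendsto_nhds_zero.1
    (hK.tendsto_lintegral_normalizedSum_sub hpos hh hnh hμ ha hA hm) _
    (ENNReal.ofReal_pos.2 (half_pos hε))] with n hn hE
  have hn' : (0 : ℝ) < n := by exact_mod_cast hn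
  set π := Measure.pi fun _ : Fin n => ν
  set F : (Fin n → E × β) → ℝ := fun D => l1Error μ K (h n) a m D with hF
  have hF0 : ∀ D, 0 ≤ F D := fun D => integral_nonneg fun x => abs_nonneg _
  have hFm : Measurable F := measurable_l1Error hK.measurable _ ha hm.measurable n
  have hmean : ∫ D, F D ∂π ≤ ε / 2 := by
    rw [integral_eq_lintegral_of_nonneg_ae (ae_of_all _ hF0) hFm.aestronglyMeasurable]
    refine ENNReal.toReal_le_of_le_ofReal (by positivity) (le_trans (le_of_eq ?_) hE)
    refine lintegral_congr fun D => ?_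
    exact ofReal_integral_norm_eq_lintegral_enorm
      ((hK.integrable_normalizedSum (hpos n) a D).sub hmi)
  have key := measureReal_ge_le_of_bounded_differences ν (F := F) hFm
    (fun D => by rw [abs_of_nonneg (hF0 D)]; exact (hc (h n) (hpos n) n D).1)
    (fun i D z => (hc (h n) (hpos n) n D).2 i z) (ε := ε / 2) (by positivity)
  refine (measureReal_mono fun D hD => ?_).trans (key.trans_eq ?_)
  · have h1 : ε ≤ F D := hD
    rw [Set.mem_ofPred_eq]
    linarith
  · congr 1
    field_simp

end RegularKernel

end Consistency

/-! ### Regression functions under nonignorable missingness -/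

section Regression

/-- The regression function `x ↦ E[a(Z) | X = x]` when `Z = (X, Y, Δ)` has law `ν`, in the version
given by the regular conditional distribution. -/
noncomputable def condMean {d : ℕ} (ν : Measure (Obs d)) [IsFiniteMeasure ν] (a : Obs d → ℝ)
    (x : EuclideanSpace ℝ (Fin d)) : ℝ :=
  ∫ y, y ∂(condDistrib a (fun z : Obs d => z.1) ν x)

/-- The σ-algebra generated by the covariate `X`. -/
abbrev sigmaX (d : ℕ) : MeasurableSpace (Obs d) :=
  MeasurableSpace.comap (fun z : Obs d => z.1) inferInstance

/-- The σ-algebra generated by `(X, Y)`. -/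
abbrev sigmaXY (d : ℕ) : MeasurableSpace (Obs d) :=
  MeasurableSpace.comap (fun z : Obs d => (z.1, z.2.1)) inferInstance

lemma sigmaXY_le (d : ℕ) : sigmaXY d ≤ Prod.instMeasurableSpace :=
  Measurable.comap_le (measurable_fst.prodMk measurable_snd.fst)

lemma sigmaX_le_sigmaXY (d : ℕ) : sigmaX d ≤ sigmaXY d := by
  have h0 : Measurable fun p : EuclideanSpace ℝ (Fin d) × ℝ => p.1 := measurable_fst
  have : Measurable[sigmaXY d] fun z : Obs d => z.1 :=
    h0.comp (comap_measurable (fun z : Obs d => (z.1, z.2.1)))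
  exact this.comap_le

lemma sigmaX_le (d : ℕ) : sigmaX d ≤ Prod.instMeasurableSpace :=
  (sigmaX_le_sigmaXY d).trans (sigmaXY_le d)

variable {d : ℕ} {ν : Measure (Obs d)} [IsProbabilityMeasure ν]

lemma measurable_condMean (a : Obs d → ℝ) : Measurable (condMean ν a) :=
  (StronglyMeasurable.integral_condDistrib (f := fun p : EuclideanSpace ℝ (Fin d) × ℝ => p.2)
    measurable_snd.stronglyMeasurable).measurable

lemma condExp_ae_eq_condMean {a : Obs d → ℝ} (ha : Integrable a ν) :
    ν[a | sigmaX d] =ᵐ[ν]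
      fun z => condMean ν a z.1 :=
  condExp_ae_eq_integral_condDistrib' measurable_fst ha

lemma isRegression_condMean {a : Obs d → ℝ} (ha : Integrable a ν) :
    IsRegression ν a (condMean ν a) := by
  have hint : Integrable (fun z : Obs d => condMean ν a z.1) ν :=
    integrable_condExp.congr (condExp_ae_eq_condMean ha)
  refine ⟨measurable_condMean a, ?_, fun φ hφ C hC => ?_⟩
  · exact (integrable_map_measure (measurable_condMean a).aestronglyMeasurable
      measurable_fst.aemeasurable).2 hint
  · have hφm : Measurable[sigmaX d]
        fun z : Obs d => φ z.1 := hφ.comp (comap_measurable _)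
    have haφ : Integrable (fun z => a z * φ z.1) ν :=
      ha.mul_bdd (c := C) (hφ.comp measurable_fst).aestronglyMeasurable
        (ae_of_all _ fun z => hC _)
    rw [integral_map (f := fun x => condMean ν a x * φ x) measurable_fst.aemeasurable
      ((measurable_condMean a).mul hφ).aestronglyMeasurable, ← integral_condExp (sigmaX_le d)]
    refine integral_congr_ae ?_
    have h1 := condExp_mul_of_stronglyMeasurable_right
      (m := sigmaX d) (f := a)
      (g := fun z => φ z.1) hφm.stronglyMeasurable haφ ha
    filter_upwards [h1, condExp_ae_eq_condMean ha] with z hz1 hz2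
    change (ν[a * fun z => φ z.1 | _]) z = _
    rw [hz1, Pi.mul_apply, hz2]

/-- The key identity of the logistic selection model: since `1 - π = exp(g + γ y) π`, conditional
means of unobserved quantities are, up to the factor `exp(g(x))`, exponentially tilted conditional
means of observed ones. -/
lemma condExp_missing_ae_eq (hΔ : ∀ᵐ z ∂ν, z.2.2 = 0 ∨ z.2.2 = 1)
    {g : EuclideanSpace ℝ (Fin d) → ℝ} (hg : Measurable g) {γ : ℝ}
    (hmodel : ∀ᵐ z ∂ν, selectionProb ν z.1 z.2.1 = 1 / (1 + Real.exp (g z.1 + γ * z.2.1)))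
    {B : ℝ} (hB : ∀ᵐ z ∂ν, Real.exp (g z.1) ≤ B) {f : ℝ → ℝ} (hf : Measurable f) {C : ℝ}
    (hC : ∀ᵐ z ∂ν, |f z.2.1| ≤ C) {T : ℝ} (hT : ∀ᵐ z ∂ν, Real.exp (γ * z.2.1) ≤ T) :
    ν[fun z => (1 - z.2.2) * f z.2.1 | sigmaX d]
      =ᵐ[ν] fun z => Real.exp (g z.1) *
        ν[fun z => z.2.2 * f z.2.1 * Real.exp (γ * z.2.1) |
          sigmaX d] z := by
  have hΔi : Integrable (fun z : Obs d => z.2.2) ν :=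
    Integrable.of_bound (by fun_prop) 1 (by
      filter_upwards [hΔ] with z hz
      rcases hz with h | h <;> simp [h])
  set u : Obs d → ℝ := fun z => f z.2.1 * (1 + Real.exp (g z.1) * Real.exp (γ * z.2.1)) with hu
  have hum : Measurable[sigmaXY d] u := by
    have h0 : Measurable fun p : EuclideanSpace ℝ (Fin d) × ℝ =>
      f p.2 * (1 + Real.exp (g p.1) * Real.exp (γ * p.2)) := by fun_prop
    exact h0.comp (comap_measurable (fun z : Obs d => (z.1, z.2.1)))
  have hub : ∀ᵐ z ∂ν, ‖u z‖ ≤ C * (1 + B * T) := by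
    filter_upwards [hC, hB, hT] with z h1 h2 h3
    rw [hu, norm_mul, Real.norm_eq_abs, Real.norm_of_nonneg (by positivity)]
    have := (Real.exp_pos (g z.1)).le.trans h2
    have := (abs_nonneg _).trans h1
    gcongr
  have hfm : Measurable[sigmaXY d] fun z : Obs d => f z.2.1 :=
    (hf.comp measurable_snd).comp (comap_measurable (fun z : Obs d => (z.1, z.2.1)))
  have hfi : Integrable (fun z : Obs d => f z.2.1) ν :=
    Integrable.of_bound (hfm.mono (sigmaXY_le d) le_rfl).aestronglyMeasurable C hC
  have hΔu : Integrable (fun z => z.2.2 * u z) ν :=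
    hΔi.mul_bdd (hum.mono (sigmaXY_le d) le_rfl).aestronglyMeasurable hub
  have hfeb : ∀ᵐ z ∂ν, ‖f z.2.1 * Real.exp (γ * z.2.1)‖ ≤ C * T := by
    filter_upwards [hC, hT] with z h1 h3
    rw [norm_mul, Real.norm_eq_abs, Real.norm_of_nonneg (by positivity)]
    have := (abs_nonneg _).trans h1
    gcongr
  have hfe : Integrable (fun z : Obs d => z.2.2 * f z.2.1 * Real.exp (γ * z.2.1)) ν := by
    simp_rw [mul_assoc]
    exact hΔi.mul_bdd (by fun_prop) hfeb
  have hGfe : Integrable (fun z : Obs d => Real.exp (g z.1) *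
      (z.2.2 * f z.2.1 * Real.exp (γ * z.2.1))) ν :=
    hfe.bdd_mul (c := B) (Real.measurable_exp.comp (hg.comp measurable_fst)).aestronglyMeasurable
      (by filter_upwards [hB] with z hz; rwa [Real.norm_of_nonneg (Real.exp_pos _).le])
  have hmiss : Integrable (fun z : Obs d => (1 - z.2.2) * f z.2.1) ν := by
    have : Integrable (fun z : Obs d => z.2.2 * f z.2.1) ν :=
      hΔi.mul_bdd (hfm.mono (sigmaXY_le d) le_rfl).aestronglyMeasurable hC
    refine (hfi.sub this).congr (ae_of_all _ fun z => ?_)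
    simp only [Pi.sub_apply]; ring
  -- given `(X, Y)`, the mean of `(1 - Δ) f(Y) - exp(g(X)) Δ f(Y) exp(γ Y)` is `f(Y) - π u = 0`
  have hzero : ν[fun z => f z.2.1 - z.2.2 * u z | sigmaXY d] =ᵐ[ν] 0 := by
    have h1 := condExp_sub (μ := ν) hfi hΔu (sigmaXY d)
    have h2 : ν[fun z : Obs d => f z.2.1 | sigmaXY d] = fun z => f z.2.1 :=
      condExp_of_stronglyMeasurable (sigmaXY_le d) hfm.stronglyMeasurable hfi
    have h3 := condExp_mul_of_stronglyMeasurable_right (m := sigmaXY d) (μ := ν)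
      (f := fun z : Obs d => z.2.2) (g := u) hum.stronglyMeasurable hΔu hΔi
    have h4 : ν[fun z : Obs d => z.2.2 | sigmaXY d] =ᵐ[ν] fun z => selectionProb ν z.1 z.2.1 :=
      condExp_ae_eq_integral_condDistrib' (X := fun z : Obs d => (z.1, z.2.1))
        (Y := fun z : Obs d => z.2.2) (by fun_prop) hΔi
    filter_upwards [h1, h3, h4, hmodel] with z e1 e3 e4 e5
    change (ν[(fun z => f z.2.1) - (fun z => z.2.2 * u z) | sigmaXY d]) z = 0
    rw [e1, Pi.sub_apply, h2]
    change _ - (ν[(fun z => z.2.2) * u | sigmaXY d]) z = 0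
    rw [e3, Pi.mul_apply, e4, e5, hu]
    simp only
    rw [Real.exp_add]
    have : 1 + Real.exp (g z.1) * Real.exp (γ * z.2.1) ≠ 0 := by positivity
    field_simp
    ring
  have htower : ν[fun z => f z.2.1 - z.2.2 * u z | sigmaX d] =ᵐ[ν] 0 := by
    have h1 := condExp_condExp_of_le (μ := ν) (f := fun z => f z.2.1 - z.2.2 * u z)
      (sigmaX_le_sigmaXY d) (sigmaXY_le d)
    have h2 := condExp_congr_ae (m := sigmaX d) hzero
    rw [condExp_zero] at h2
    exact h1.symm.trans h2
  have hsub := condExp_sub (μ := ν) hmiss hGfe (sigmaX d)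
  have hpull := condExp_mul_of_stronglyMeasurable_left (m := sigmaX d) (μ := ν)
    (f := fun z : Obs d => Real.exp (g z.1))
    (g := fun z => z.2.2 * f z.2.1 * Real.exp (γ * z.2.1))
    (Measurable.stronglyMeasurable
      ((Real.measurable_exp.comp hg).comp (comap_measurable (fun z : Obs d => z.1)))) hGfe hfe
  have heq : (fun z : Obs d => f z.2.1 - z.2.2 * u z) =
      (fun z => (1 - z.2.2) * f z.2.1) -
        fun z => Real.exp (g z.1) * (z.2.2 * f z.2.1 * Real.exp (γ * z.2.1)) := by
    funext z
    simp only [hu, Pi.sub_apply]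
    ring
  rw [heq] at htower
  filter_upwards [htower, hsub, hpull] with z e1 e2 e3
  rw [e2, Pi.sub_apply] at e1
  have e4 : (ν[fun z => Real.exp (g z.1) *
      (z.2.2 * f z.2.1 * Real.exp (γ * z.2.1)) | sigmaX d]) z = _ := e3
  rw [e4, Pi.mul_apply] at e1
  simp only [Pi.zero_apply] at e1
  linarith

end Regression

/-! ### Deterministic error bounds for the plug-in estimator -/

section Deterministic

variable {ι : Type*} [Fintype ι]

lemma abs_sum_mul_le {y q : ι → ℝ} {L : ℝ} (hy : ∀ i, |y i| ≤ L) (hq : ∀ i, 0 ≤ q i) :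
    |∑ i, y i * q i| ≤ L * ∑ i, q i := by
  rw [Finset.mul_sum]
  refine (Finset.abs_sum_le_sum_abs _ _).trans (Finset.sum_le_sum fun i _ => ?_)
  rw [abs_mul, abs_of_nonneg (hq i)]
  exact mul_le_mul_of_nonneg_right (hy i) (hq i)

lemma abs_div_le_of_abs_le_mul {u v L : ℝ} (hL : 0 ≤ L) (hv : 0 ≤ v) (h : |u| ≤ L * v) :
    |u / v| ≤ L := by
  rw [abs_div, abs_of_nonneg hv]
  exact div_le_of_le_mul₀ hv hL h

/-- A weighted mean of values in `[-L, L]` moves by at most `2 L τ` when the weights change by a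
relative amount `τ`. With the convention `0 / 0 = 0` no positivity of the total weight is needed:
a vanishing total forces all weights to vanish. -/
lemma abs_weightedMean_sub_le {y p q : ι → ℝ} {L τ : ℝ} (hL : 0 ≤ L) (hτ : 0 ≤ τ)
    (hy : ∀ i, |y i| ≤ L) (hp : ∀ i, 0 ≤ p i) (hq : ∀ i, 0 ≤ q i)
    (hpq : ∀ i, |q i - p i| ≤ τ * q i) :
    |(∑ i, y i * q i) / ∑ i, q i - (∑ i, y i * p i) / ∑ i, p i| ≤ 2 * L * τ := by
  set R := (∑ i, y i * p i) / ∑ i, p i with hR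
  have hP0 : 0 ≤ ∑ i, p i := Finset.sum_nonneg fun i _ => hp i
  have hQ0 : 0 ≤ ∑ i, q i := Finset.sum_nonneg fun i _ => hq i
  have hRL : |R| ≤ L := abs_div_le_of_abs_le_mul hL hP0 (abs_sum_mul_le hy hp)
  have hR0 : R * ∑ i, p i = ∑ i, y i * p i := by
    rcases hP0.eq_or_lt with h0 | h0
    · have := abs_sum_mul_le hy hp
      rw [← h0, mul_zero] at this
      rw [← h0, mul_zero, abs_nonpos_iff.1 this]
    · rw [hR, div_mul_cancel₀ _ h0.ne']
  rcases hQ0.eq_or_lt with h0 | h0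
  · have hq0 : ∀ i, q i = 0 := fun i =>
      (Finset.sum_eq_zero_iff_of_nonneg fun i _ => hq i).1 h0.symm i (Finset.mem_univ i)
    have hp0 : ∀ i, p i = 0 := fun i => by
      have := hpq i
      rw [hq0, mul_zero, zero_sub, abs_neg] at this
      exact abs_nonpos_iff.1 this
    simp only [hR, hp0, hq0, mul_zero, Finset.sum_const_zero, div_zero, sub_zero, abs_zero]
    positivity
  · have h1 : (∑ i, y i * q i) / ∑ i, q i - R = (∑ i, (y i - R) * (q i - p i)) / ∑ i, q i := by
      have : ∑ i, (y i - R) * (q i - p i) = ∑ i, y i * q i - R * ∑ i, q i := by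
        have h2 : ∑ i, (y i - R) * (q i - p i) =
            (∑ i, y i * q i - R * ∑ i, q i) - (∑ i, y i * p i - R * ∑ i, p i) := by
          simp only [Finset.mul_sum, ← Finset.sum_sub_distrib]
          exact Finset.sum_congr rfl fun i _ => by ring
        rw [h2, hR0]; ring
      rw [this]
      field_simp
    rw [h1]
    refine abs_div_le_of_abs_le_mul (by positivity) hQ0 ?_
    rw [Finset.mul_sum]
    refine (Finset.abs_sum_le_sum_abs _ _).trans (Finset.sum_le_sum fun i _ => ?_)
    rw [abs_mul]
    calc |y i - R| * |q i - p i| ≤ (L + L) * (τ * q i) := by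
          gcongr
          · exact (abs_sub _ _).trans (add_le_add (hy i) hRL)
          · exact hpq i
      _ = _ := by ring

/-- Stability of `(s, n₀, n₁, n₂, n₃) ↦ n₀ / s + n₁ / n₂ * (1 - n₃ / s)` around a point with `s = 1`
and `n₂ ≥ κ`. Multiplying an error of a quotient by the deterministic denominator
avoids any lower bound on the random denominators `s` and `n₂`. -/
lemma abs_plugIn_sub_le {L κ s n₀ n₁ n₂ n₃ m₀ m₁ m₂ m₃ : ℝ} (hL : 0 ≤ L) (hκ : 0 < κ)
    (hs : 0 ≤ s) (h0 : |n₀| ≤ L * s) (hn2 : 0 ≤ n₂) (h1 : |n₁| ≤ L * n₂) (h3 : 0 ≤ n₃)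
    (h3s : n₃ ≤ s) (hm2 : κ ≤ m₂) (hm1 : |m₁| ≤ L * m₂) :
    |(n₀ / s + n₁ / n₂ * (1 - n₃ / s)) - (m₀ + m₁ / m₂ * (1 - m₃))| ≤
      (1 + 2 * L + (1 + L) / κ) *
        (|s - 1| + |n₀ - m₀| + |n₁ - m₁| + |n₂ - m₂| + |n₃ - m₃|) := by
  have hm2' : 0 < m₂ := hκ.trans_le hm2
  have quot : ∀ {u l m : ℝ}, 0 ≤ l → |u| ≤ l * s → |u / s - m| ≤ |u - m| + l * |s - 1| := by
    intro u l m hl hu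
    have hus : u / s * s = u := by
      rcases hs.eq_or_lt with h | h
      · rw [← h, mul_zero] at hu
        rw [← h, mul_zero, abs_nonpos_iff.1 hu]
      · exact div_mul_cancel₀ _ h.ne'
    have h2 : u / s - m = (u - m) - u / s * (s - 1) := by
      rw [mul_sub, hus]; ring
    rw [h2]
    refine (abs_sub _ _).trans ?_
    rw [abs_mul]
    gcongr
    exact abs_div_le_of_abs_le_mul hl hs hu
  have e0 := quot (m := m₀) hL h0
  have e3 := quot (u := n₃) (m := m₃) zero_le_one (by rwa [abs_of_nonneg h3, one_mul])
  have hR : |n₁ / n₂| ≤ L := abs_div_le_of_abs_le_mul hL hn2 h1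
  have hM : |m₁ / m₂| ≤ L := abs_div_le_of_abs_le_mul hL hm2'.le hm1
  have e1 : |n₁ / n₂ - m₁ / m₂| ≤ (|n₁ - m₁| + L * |n₂ - m₂|) / κ := by
    have hn : n₁ / n₂ * n₂ = n₁ := by
      rcases hn2.eq_or_lt with h | h
      · rw [← h, mul_zero] at h1
        rw [← h, mul_zero, abs_nonpos_iff.1 h1]
      · exact div_mul_cancel₀ _ h.ne'
    have h2 : (n₁ / n₂ - m₁ / m₂) * m₂ = (n₁ - m₁) - n₁ / n₂ * (n₂ - m₂) := by
      rw [mul_sub, hn, sub_mul, div_mul_cancel₀ _ hm2'.ne']; ring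
    rw [le_div_iff₀ hκ]
    calc |n₁ / n₂ - m₁ / m₂| * κ ≤ |n₁ / n₂ - m₁ / m₂| * m₂ := by gcongr
      _ = |(n₁ - m₁) - n₁ / n₂ * (n₂ - m₂)| := by rw [← h2, abs_mul, abs_of_pos hm2']
      _ ≤ |n₁ - m₁| + |n₁ / n₂| * |n₂ - m₂| := by
        refine (abs_sub _ _).trans ?_
        rw [abs_mul]
      _ ≤ _ := by gcongr
  have hfrac : |1 - n₃ / s| ≤ 1 := by
    have h4 : 0 ≤ n₃ / s := div_nonneg h3 hs
    have h5 : n₃ / s ≤ 1 := div_le_one_of_le₀ h3s hs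
    rw [abs_le]; constructor <;> linarith
  have hdec : (n₀ / s + n₁ / n₂ * (1 - n₃ / s)) - (m₀ + m₁ / m₂ * (1 - m₃)) =
      (n₀ / s - m₀) + (n₁ / n₂ - m₁ / m₂) * (1 - n₃ / s) - m₁ / m₂ * (n₃ / s - m₃) := by ring
  calc _ ≤ |n₀ / s - m₀| + |n₁ / n₂ - m₁ / m₂| * |1 - n₃ / s| + |m₁ / m₂| * |n₃ / s - m₃| := by
        rw [hdec, ← abs_mul, ← abs_mul]
        exact (abs_sub _ _).trans (add_le_add_left (abs_add_le _ _) _)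
    _ ≤ (|n₀ - m₀| + L * |s - 1|) + (|n₁ - m₁| + L * |n₂ - m₂|) / κ * 1 +
        L * (|n₃ - m₃| + 1 * |s - 1|) := by gcongr
    _ ≤ _ := by
        have a1 := abs_nonneg (s - 1)
        have a2 := abs_nonneg (n₀ - m₀)
        have a3 := abs_nonneg (n₁ - m₁)
        have a4 := abs_nonneg (n₂ - m₂)
        have a5 := abs_nonneg (n₃ - m₃)
        have k : (1 + L) / κ = κ⁻¹ + L * κ⁻¹ := by field_simp
        have k' : (|n₁ - m₁| + L * |n₂ - m₂|) / κ = κ⁻¹ * |n₁ - m₁| + L * κ⁻¹ * |n₂ - m₂| := by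
          field_simp
        rw [k, k']
        have b : 0 ≤ κ⁻¹ := by positivity
        have b' : 0 ≤ L * κ⁻¹ := by positivity
        nlinarith [mul_nonneg hL a1, mul_nonneg hL a2, mul_nonneg hL a3, mul_nonneg hL a4,
          mul_nonneg hL a5, mul_nonneg b a1, mul_nonneg b a2, mul_nonneg b a3, mul_nonneg b a4,
          mul_nonneg b a5, mul_nonneg b' a1, mul_nonneg b' a2, mul_nonneg b' a3,
          mul_nonneg b' a4, mul_nonneg b' a5]

end Deterministic

/-! ### The five regression functions behind the estimator -/

section Features

variable {d : ℕ}

/-- The observations allowed by the model: `|y| ≤ L` and `δ ∈ {0, 1}`. -/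
def admissible (d : ℕ) (L : ℝ) : Set (Obs d) := {z | |z.2.1| ≤ L ∧ (z.2.2 = 0 ∨ z.2.2 = 1)}

/-- The functions `1`, `δ y`, `δ y exp(γ y)`, `δ exp(γ y)`, `δ` of an observation whose kernel
averages make up the plug-in estimator. -/
noncomputable def rawFeature (d : ℕ) (γ : ℝ) : Fin 5 → Obs d → ℝ :=
  ![fun _ => 1, fun z => z.2.2 * z.2.1, fun z => z.2.2 * z.2.1 * Real.exp (γ * z.2.1),
    fun z => z.2.2 * Real.exp (γ * z.2.1), fun z => z.2.2]

/-- The functions `rawFeature`, set to `0` at observations that are not admissible (a null event) so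
that they are bounded everywhere. -/
noncomputable def feature (d : ℕ) (L γ : ℝ) (j : Fin 5) : Obs d → ℝ :=
  (admissible d L).indicator (rawFeature d γ j)

lemma measurableSet_admissible (d : ℕ) (L : ℝ) : MeasurableSet (admissible d L) := by
  have h1 : Measurable fun z : Obs d => z.2.1 := by fun_prop
  have h2 : Measurable fun z : Obs d => z.2.2 := by fun_prop
  exact (measurableSet_le h1.abs measurable_const).inter
    ((h2 (measurableSet_singleton 0)).union (h2 (measurableSet_singleton 1)))

lemma measurable_rawFeature (γ : ℝ) (j : Fin 5) : Measurable (rawFeature d γ j) := by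
  fin_cases j <;> simp only [rawFeature] <;> simp <;> fun_prop

lemma measurable_feature (L γ : ℝ) (j : Fin 5) : Measurable (feature d L γ j) :=
  (measurable_rawFeature γ j).indicator (measurableSet_admissible d L)

lemma exp_mul_le_of_abs_le {γ y L : ℝ} (hy : |y| ≤ L) : Real.exp (γ * y) ≤ Real.exp (|γ| * L) := by
  refine Real.exp_le_exp.2 ((le_abs_self _).trans ?_)
  rw [abs_mul]
  gcongr

lemma le_exp_mul_of_abs_le {γ y L : ℝ} (hy : |y| ≤ L) :
    Real.exp (-(|γ| * L)) ≤ Real.exp (γ * y) := by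
  refine Real.exp_le_exp.2 (le_trans ?_ (neg_abs_le _))
  rw [abs_mul]
  gcongr

lemma abs_rawFeature_le {L γ : ℝ} {z : Obs d} (hz : z ∈ admissible d L) (j : Fin 5) :
    |rawFeature d γ j z| ≤ (1 + L) * Real.exp (|γ| * L) := by
  obtain ⟨hy, hδ⟩ := hz
  have hL : 0 ≤ L := (abs_nonneg _).trans hy
  have he := exp_mul_le_of_abs_le (γ := γ) hy
  have h1 : 1 ≤ Real.exp (|γ| * L) := Real.one_le_exp (by positivity)
  have hδ1 : |z.2.2| ≤ 1 := by rcases hδ with h | h <;> simp [h]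
  have hp := Real.exp_pos (γ * z.2.1)
  have hLE : 0 ≤ L * Real.exp (|γ| * L) := by positivity
  fin_cases j
  · simp [rawFeature]; nlinarith
  · simp [rawFeature, abs_mul]
    calc |z.2.2| * |z.2.1| ≤ 1 * L := by gcongr
      _ ≤ _ := by nlinarith
  · simp [rawFeature, abs_mul]
    calc |z.2.2| * |z.2.1| * Real.exp (γ * z.2.1) ≤ 1 * L * Real.exp (|γ| * L) := by gcongr
      _ ≤ _ := by nlinarith
  · simp [rawFeature, abs_mul]
    calc |z.2.2| * Real.exp (γ * z.2.1) ≤ 1 * Real.exp (|γ| * L) := by gcongr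
      _ ≤ _ := by nlinarith
  · simp [rawFeature]; nlinarith

lemma abs_feature_le {L : ℝ} (hL : 0 ≤ L) (γ : ℝ) (j : Fin 5) (z : Obs d) :
    |feature d L γ j z| ≤ (1 + L) * Real.exp (|γ| * L) := by
  by_cases hz : z ∈ admissible d L
  · rw [feature, Set.indicator_of_mem hz]
    exact abs_rawFeature_le hz j
  · rw [feature, Set.indicator_of_notMem hz, abs_zero]
    positivity

lemma feature_ae_eq {ν : Measure (Obs d)} {L : ℝ} (hadm : ∀ᵐ z ∂ν, z ∈ admissible d L)
    (γ : ℝ) (j : Fin 5) : feature d L γ j =ᵐ[ν] rawFeature d γ j := by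
  filter_upwards [hadm] with z hz
  rw [feature, Set.indicator_of_mem hz]

variable {ν : Measure (Obs d)} [IsProbabilityMeasure ν]

lemma integrable_feature {L : ℝ} (hL : 0 ≤ L) (γ : ℝ) (j : Fin 5) :
    Integrable (feature d L γ j) ν :=
  Integrable.of_bound (measurable_feature L γ j).aestronglyMeasurable _
    (ae_of_all _ fun z => abs_feature_le hL γ j z)

/-- The regression function is the plug-in functional of the regression functions of the features,
with denominator bounded below. -/
lemma ae_condMean_feature {L : ℝ} (hL : 0 ≤ L) (hadm : ∀ᵐ z ∂ν, z ∈ admissible d L)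
    {g : EuclideanSpace ℝ (Fin d) → ℝ} (hg : Measurable g) {γ : ℝ}
    (hmodel : ∀ᵐ z ∂ν, selectionProb ν z.1 z.2.1 = 1 / (1 + Real.exp (g z.1 + γ * z.2.1)))
    {πmin : ℝ} (hπ0 : 0 < πmin) (hπ : ∀ᵐ z ∂ν, πmin ≤ selectionProb ν z.1 z.2.1) :
    ∀ᵐ x ∂(ν.map Prod.fst), condMean ν (feature d L γ 0) x = 1 ∧
      regressionFun ν x = condMean ν (feature d L γ 1) x +
        condMean ν (feature d L γ 2) x / condMean ν (feature d L γ 3) x *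
          (1 - condMean ν (feature d L γ 4) x) ∧
      Real.exp (-(|γ| * L)) * πmin ≤ condMean ν (feature d L γ 3) x ∧
      |condMean ν (feature d L γ 2) x| ≤ L * condMean ν (feature d L γ 3) x ∧
      |regressionFun ν x| ≤ L := by
  have hm : ∀ j, Measurable (condMean ν (feature d L γ j)) := fun j => measurable_condMean _
  have hmr : Measurable (regressionFun ν) := measurable_condMean (fun z : Obs d => z.2.1)
  have hset : MeasurableSet {x | condMean ν (feature d L γ 0) x = 1 ∧
      regressionFun ν x = condMean ν (feature d L γ 1) x +
        condMean ν (feature d L γ 2) x / condMean ν (feature d L γ 3) x *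
          (1 - condMean ν (feature d L γ 4) x) ∧
      Real.exp (-(|γ| * L)) * πmin ≤ condMean ν (feature d L γ 3) x ∧
      |condMean ν (feature d L γ 2) x| ≤ L * condMean ν (feature d L γ 3) x ∧
      |regressionFun ν x| ≤ L} :=
    (measurableSet_eq_fun (hm 0) measurable_const).inter <|
    (measurableSet_eq_fun hmr
      ((hm 1).add (((hm 2).div (hm 3)).mul ((hm 4).const_sub 1)))).inter <|
    (measurableSet_le measurable_const (hm 3)).inter <|
    (measurableSet_le (hm 2).abs ((hm 3).const_mul L)).inter
      (measurableSet_le hmr.abs measurable_const)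
  rw [ae_map_iff measurable_fst.aemeasurable hset]
  have hΔ : ∀ᵐ z ∂ν, z.2.2 = 0 ∨ z.2.2 = 1 := hadm.mono fun z hz => hz.2
  have hYi : Integrable (fun z : Obs d => z.2.1) ν :=
    Integrable.of_bound (by fun_prop) L (hadm.mono fun z hz => hz.1)
  have hraw : ∀ j, Integrable (rawFeature d γ j) ν := fun j =>
    (integrable_feature hL γ j).congr (feature_ae_eq hadm γ j)
  have hΔi : Integrable (fun z : Obs d => z.2.2) ν := hraw 4
  have hΔY : Integrable (fun z : Obs d => z.2.2 * z.2.1) ν := hraw 1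
  have hcm : ∀ j, ν[rawFeature d γ j | sigmaX d] =ᵐ[ν] fun z => condMean ν (feature d L γ j) z.1 :=
    fun j => (condExp_congr_ae (feature_ae_eq hadm γ j)).symm.trans
      (condExp_ae_eq_condMean (integrable_feature hL γ j))
  have hcr : ν[fun z => z.2.1 | sigmaX d] =ᵐ[ν] fun z => regressionFun ν z.1 :=
    condExp_ae_eq_condMean hYi
  -- the selection probability bound makes the nuisance factor `exp(g(x))` bounded
  have hB : ∀ᵐ z ∂ν, Real.exp (g z.1) ≤ Real.exp (|γ| * L) / πmin := by
    filter_upwards [hmodel, hπ, hadm] with z h1 h2 h3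
    rw [h1, Real.exp_add, le_div_iff₀ (by positivity)] at h2
    have h4 := le_exp_mul_of_abs_le (γ := γ) h3.1
    rw [Real.exp_neg, inv_le_iff_one_le_mul₀ (Real.exp_pos _)] at h4
    rw [le_div_iff₀ hπ0]
    have h5 : πmin * (Real.exp (g z.1) * Real.exp (γ * z.2.1)) ≤ 1 := by nlinarith
    calc Real.exp (g z.1) * πmin ≤
          Real.exp (g z.1) * πmin * (Real.exp (|γ| * L) * Real.exp (γ * z.2.1)) :=
          le_mul_of_one_le_right (by positivity) (by linarith)
      _ = (πmin * (Real.exp (g z.1) * Real.exp (γ * z.2.1))) * Real.exp (|γ| * L) := by ring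
      _ ≤ 1 * Real.exp (|γ| * L) := by gcongr
      _ = _ := one_mul _
  have hT : ∀ᵐ z ∂ν, Real.exp (γ * z.2.1) ≤ Real.exp (|γ| * L) :=
    hadm.mono fun z hz => exp_mul_le_of_abs_le hz.1
  have hmissY := condExp_missing_ae_eq hΔ hg hmodel hB (f := fun y => y) measurable_id
    (hadm.mono fun z hz => hz.1) hT
  have hmiss1 := condExp_missing_ae_eq hΔ hg hmodel hB (f := fun _ => 1) measurable_const
    (C := 1) (ae_of_all _ fun z => by simp) hT
  simp only [mul_one] at hmiss1
  have hone : ν[rawFeature d γ 0 | sigmaX d] = fun _ => 1 := condExp_const (sigmaX_le d) 1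
  have hY : ν[fun z => z.2.1 | sigmaX d] =ᵐ[ν]
      ν[rawFeature d γ 1 | sigmaX d] + ν[fun z => (1 - z.2.2) * z.2.1 | sigmaX d] := by
    have h1 : Integrable (fun z : Obs d => (1 - z.2.2) * z.2.1) ν :=
      (hYi.sub hΔY).congr (ae_of_all _ fun z => by simp only [Pi.sub_apply]; ring)
    refine EventuallyEq.trans (EventuallyEq.of_eq ?_) (condExp_add (hraw 1) h1 _)
    congr 1
    funext z
    simp only [rawFeature, Pi.add_apply, Matrix.cons_val_one, Matrix.cons_val_zero]
    ring
  have hΔ1 : ν[fun z => 1 - z.2.2 | sigmaX d] =ᵐ[ν]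
      ν[rawFeature d γ 0 | sigmaX d] - ν[rawFeature d γ 4 | sigmaX d] :=
    condExp_sub (hraw 0) (hraw 4) _
  have hsel : ∀ᵐ z ∂ν, πmin ≤ (ν[rawFeature d γ 4 | sigmaX d]) z := by
    have h1 : ν[rawFeature d γ 4 | sigmaXY d] =ᵐ[ν] fun z => selectionProb ν z.1 z.2.1 :=
      condExp_ae_eq_integral_condDistrib' (X := fun z : Obs d => (z.1, z.2.1))
        (Y := fun z : Obs d => z.2.2) (by fun_prop) hΔi
    have h2 := condExp_condExp_of_le (μ := ν) (f := rawFeature d γ 4) (sigmaX_le_sigmaXY d)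
      (sigmaXY_le d)
    have h3 : (fun _ => πmin) ≤ᵐ[ν] ν[rawFeature d γ 4 | sigmaXY d] := by
      filter_upwards [h1, hπ] with z e1 e2
      rwa [e1]
    have h4 := condExp_mono (m := sigmaX d) (integrable_const πmin) integrable_condExp h3
    rw [condExp_const (sigmaX_le d)] at h4
    filter_upwards [h2, h4] with z e2 e4
    rwa [← e2]
  have hlow : ∀ᵐ z ∂ν, Real.exp (-(|γ| * L)) * (ν[rawFeature d γ 4 | sigmaX d]) z ≤
      (ν[rawFeature d γ 3 | sigmaX d]) z := by
    have h1 : Real.exp (-(|γ| * L)) • rawFeature d γ 4 ≤ᵐ[ν] rawFeature d γ 3 := by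
      filter_upwards [hadm] with z hz
      have h2 := le_exp_mul_of_abs_le (γ := γ) hz.1
      have h3 : 0 ≤ z.2.2 := by rcases hz.2 with h | h <;> simp [h]
      change Real.exp (-(|γ| * L)) * z.2.2 ≤ z.2.2 * Real.exp (γ * z.2.1)
      nlinarith
    have h4 := condExp_mono (m := sigmaX d) ((hraw 4).smul _) (hraw 3) h1
    filter_upwards [h4, condExp_smul (μ := ν) (Real.exp (-(|γ| * L))) (rawFeature d γ 4)
      (sigmaX d)] with z e1 e2
    rw [e2] at e1
    exact e1
  have habs : ∀ s : ℝ, |s| = 1 → ∀ᵐ z ∂ν, s * (ν[rawFeature d γ 2 | sigmaX d]) z ≤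
      L * (ν[rawFeature d γ 3 | sigmaX d]) z := by
    intro s hs
    have h1 : s • rawFeature d γ 2 ≤ᵐ[ν] L • rawFeature d γ 3 := by
      filter_upwards [hadm] with z hz
      have h3 : 0 ≤ z.2.2 * Real.exp (γ * z.2.1) := by 
        rcases hz.2 with h | h <;> simp [h, Real.exp_nonneg]
      have h4 : s * z.2.1 ≤ L := by
        refine (le_abs_self _).trans ?_
        rw [abs_mul, hs, one_mul]
        exact hz.1
      change s * (z.2.2 * z.2.1 * Real.exp (γ * z.2.1)) ≤ L * (z.2.2 * Real.exp (γ * z.2.1))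
      calc _ = s * z.2.1 * (z.2.2 * Real.exp (γ * z.2.1)) := by ring
        _ ≤ _ := by gcongr
    have h4 := condExp_mono (m := sigmaX d) ((hraw 2).smul s) ((hraw 3).smul L) h1
    filter_upwards [h4, condExp_smul (μ := ν) s (rawFeature d γ 2) (sigmaX d),
      condExp_smul (μ := ν) L (rawFeature d γ 3) (sigmaX d)] with z e1 e2 e3
    rw [e2, e3] at e1
    exact e1
  have hYL : ∀ᵐ z ∂ν, |(ν[fun z => z.2.1 | sigmaX d]) z| ≤ L := by
    have h1 := condExp_mono (m := sigmaX d) hYi (integrable_const L)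
      (hadm.mono fun z hz => (abs_le.1 hz.1).2)
    have h2 := condExp_mono (m := sigmaX d) (integrable_const (-L)) hYi
      (hadm.mono fun z hz => (abs_le.1 hz.1).1)
    rw [condExp_const (sigmaX_le d)] at h1 h2
    filter_upwards [h1, h2] with z e1 e2
    exact abs_le.2 ⟨e2, e1⟩
  filter_upwards [hcm 0, hcm 1, hcm 2, hcm 3, hcm 4, hcr, hmissY, hmiss1, hY, hΔ1, hsel, hlow,
    habs 1 (by simp), habs (-1) (by simp), hYL] with z c0 c1 c2 c3 c4 cr eY e1 dY d1 hs hl ha hb hyl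
  have t2 : (ν[fun z : Obs d => z.2.2 * z.2.1 * Real.exp (γ * z.2.1) | sigmaX d]) z =
      condMean ν (feature d L γ 2) z.1 := c2
  have t3 : (ν[fun z : Obs d => z.2.2 * Real.exp (γ * z.2.1) | sigmaX d]) z =
      condMean ν (feature d L γ 3) z.1 := c3
  rw [t2] at eY
  rw [t3] at e1
  rw [Pi.add_apply, cr, c1, eY] at dY
  rw [Pi.sub_apply, e1, hone, c4] at d1
  rw [hone] at c0
  rw [c4] at hs
  rw [c3, c4] at hl
  rw [c2, c3] at ha hb
  rw [cr] at hyl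
  have hk : Real.exp (-(|γ| * L)) * πmin ≤ condMean ν (feature d L γ 3) z.1 :=
    (mul_le_mul_of_nonneg_left hs (Real.exp_pos _).le).trans hl
  have hk0 : 0 < condMean ν (feature d L γ 3) z.1 :=
    (mul_pos (Real.exp_pos _) hπ0).trans_le hk
  refine ⟨c0.symm, ?_, hk, abs_le.2 ⟨by linarith, by linarith⟩, hyl⟩
  rw [dY, ← d1]
  field_simp

end Features

/-! ### From kernel sums to the plug-in estimator -/

section Estimator

variable {d n : ℕ} {K : EuclideanSpace ℝ (Fin d) → ℝ} {L : ℝ}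

lemma etaHat_one_div_etaHat_two (hK : ∀ u, 0 ≤ K u) (h : ℝ) (D : Fin n → Obs d) (γ : ℝ)
    (x : EuclideanSpace ℝ (Fin d)) :
    etaHat K h D 1 γ x / etaHat K h D 2 γ x =
      (∑ i, (D i).2.1 * ((D i).2.2 * Real.exp (γ * (D i).2.1) * K (h⁻¹ • (x - (D i).1)))) /
        ∑ i, (D i).2.2 * Real.exp (γ * (D i).2.1) * K (h⁻¹ • (x - (D i).1)) := by
  have e1 : ∑ i, (D i).2.2 * (D i).2.1 ^ (2 - 1) * Real.exp (γ * (D i).2.1) *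
      K (h⁻¹ • (x - (D i).1)) =
      ∑ i, (D i).2.1 * ((D i).2.2 * Real.exp (γ * (D i).2.1) * K (h⁻¹ • (x - (D i).1))) :=
    Finset.sum_congr rfl fun i _ => by norm_num; ring
  have e2 : ∑ i, (D i).2.2 * (D i).2.1 ^ (2 - 2) * Real.exp (γ * (D i).2.1) *
      K (h⁻¹ • (x - (D i).1)) =
      ∑ i, (D i).2.2 * Real.exp (γ * (D i).2.1) * K (h⁻¹ • (x - (D i).1)) :=
    Finset.sum_congr rfl fun i _ => by norm_num
  rw [etaHat, etaHat, e1, e2]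
  by_cases hT : ∑ i, K (h⁻¹ • (x - (D i).1)) = 0
  · have hk : ∀ i, K (h⁻¹ • (x - (D i).1)) = 0 := fun i =>
      (Finset.sum_eq_zero_iff_of_nonneg fun i _ => hK _).1 hT i (Finset.mem_univ i)
    simp [hk]
  · rw [div_div_div_cancel_right₀ hT]

lemma abs_exp_sub_one_le_exp_abs_sub_one (u : ℝ) : |Real.exp u - 1| ≤ Real.exp |u| - 1 := by
  rcases le_total 0 u with h | h
  · rw [abs_of_nonneg h, abs_of_nonneg (by linarith [Real.add_one_le_exp u])]
  · rw [abs_of_nonpos h, abs_of_nonpos (by linarith [Real.exp_le_one_iff.2 h])]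
    linarith [Real.add_one_le_exp u, Real.add_one_le_exp (-u)]

lemma nonneg_of_admissible {z : Obs d} (hz : z ∈ admissible d L) : 0 ≤ z.2.2 := by
  rcases hz.2 with h | h <;> simp [h]

lemma le_one_of_admissible {z : Obs d} (hz : z ∈ admissible d L) : z.2.2 ≤ 1 := by
  rcases hz.2 with h | h <;> simp [h]

/-- The estimated response probability `η̂₂(x, 0)` lies in `[0, 1]`, so the factor `1 - η̂₂(x, 0)`
never amplifies errors. -/
lemma etaHat_two_zero_mem (hK : ∀ u, 0 ≤ K u) (h : ℝ) {D : Fin n → Obs d}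
    (hD : ∀ i, D i ∈ admissible d L) (x : EuclideanSpace ℝ (Fin d)) :
    0 ≤ etaHat K h D 2 0 x ∧ etaHat K h D 2 0 x ≤ 1 := by
  simp only [etaHat, zero_mul, Real.exp_zero, mul_one, Nat.sub_self, pow_zero]
  have h0 : 0 ≤ ∑ i, K (h⁻¹ • (x - (D i).1)) := Finset.sum_nonneg fun i _ => hK _
  refine ⟨div_nonneg (Finset.sum_nonneg fun i _ =>
    mul_nonneg (nonneg_of_admissible (hD i)) (hK _)) h0, div_le_one_of_le₀ ?_ h0⟩
  exact Finset.sum_le_sum fun i _ => mul_le_of_le_one_left (hK _) (le_one_of_admissible (hD i))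

lemma abs_etaHat_ratio_le (hL : 0 ≤ L) (hK : ∀ u, 0 ≤ K u) (h : ℝ) {D : Fin n → Obs d}
    (hD : ∀ i, D i ∈ admissible d L) (γ : ℝ) (x : EuclideanSpace ℝ (Fin d)) :
    |etaHat K h D 1 γ x / etaHat K h D 2 γ x| ≤ L := by
  have hq : ∀ i, 0 ≤ (D i).2.2 * Real.exp (γ * (D i).2.1) * K (h⁻¹ • (x - (D i).1)) := fun i =>
    mul_nonneg (mul_nonneg (nonneg_of_admissible (hD i)) (Real.exp_pos _).le) (hK _)
  rw [etaHat_one_div_etaHat_two hK]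
  exact abs_div_le_of_abs_le_mul hL (Finset.sum_nonneg fun i _ => hq i)
    (abs_sum_mul_le (fun i => (hD i).1) hq)

lemma abs_mHat_le (hL : 0 ≤ L) (hK : ∀ u, 0 ≤ K u) (h : ℝ) {D : Fin n → Obs d}
    (hD : ∀ i, D i ∈ admissible d L) (γ : ℝ) (x : EuclideanSpace ℝ (Fin d)) :
    |mHat K h D γ x| ≤ 2 * L := by
  have h1 : |etaHat K h D 1 0 x| ≤ L := by
    have h0 : 0 ≤ ∑ i, K (h⁻¹ • (x - (D i).1)) := Finset.sum_nonneg fun i _ => hK _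
    refine abs_div_le_of_abs_le_mul hL h0 ?_
    refine le_trans (le_of_eq ?_) (abs_sum_mul_le (y := fun i => (D i).2.2 * (D i).2.1)
      (fun i => ?_) fun i => hK (h⁻¹ • (x - (D i).1)))
    · simp
    · rw [abs_mul, abs_of_nonneg (nonneg_of_admissible (hD i))]
      exact (mul_le_of_le_one_left (abs_nonneg _) (le_one_of_admissible (hD i))).trans (hD i).1
  obtain ⟨h2, h3⟩ := etaHat_two_zero_mem hK h hD x
  calc |mHat K h D γ x| ≤ |etaHat K h D 1 0 x| +
        |etaHat K h D 1 γ x / etaHat K h D 2 γ x| * |1 - etaHat K h D 2 0 x| := by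
        rw [← abs_mul]
        exact abs_add_le _ _
    _ ≤ L + L * 1 := by
        gcongr
        · exact abs_etaHat_ratio_le hL hK h hD γ x
        · rw [abs_le]; constructor <;> linarith
    _ = 2 * L := by ring

/-- The estimator is continuous in the tilt parameter, uniformly over admissible samples. -/
lemma abs_mHat_sub_mHat_le (hL : 0 ≤ L) (hK : ∀ u, 0 ≤ K u) (h : ℝ) {D : Fin n → Obs d}
    (hD : ∀ i, D i ∈ admissible d L) (γ γ' : ℝ) (x : EuclideanSpace ℝ (Fin d)) :
    |mHat K h D γ x - mHat K h D γ' x| ≤ 2 * L * (Real.exp (L * |γ - γ'|) - 1) := by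
  have hτ : 0 ≤ Real.exp (L * |γ - γ'|) - 1 := by
    linarith [Real.one_le_exp (by positivity : 0 ≤ L * |γ - γ'|)]
  have hq : ∀ γ i, 0 ≤ (D i).2.2 * Real.exp (γ * (D i).2.1) * K (h⁻¹ • (x - (D i).1)) :=
    fun γ i => mul_nonneg (mul_nonneg (nonneg_of_admissible (hD i)) (Real.exp_pos _).le) (hK _)
  have hratio : |etaHat K h D 1 γ x / etaHat K h D 2 γ x -
      etaHat K h D 1 γ' x / etaHat K h D 2 γ' x| ≤ 2 * L * (Real.exp (L * |γ - γ'|) - 1) := by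
    rw [etaHat_one_div_etaHat_two hK, etaHat_one_div_etaHat_two hK]
    refine abs_weightedMean_sub_le hL hτ (fun i => (hD i).1) (hq γ') (hq γ) fun i => ?_
    set y := (D i).2.1 with hy
    have h1 : (D i).2.2 * Real.exp (γ * y) * K (h⁻¹ • (x - (D i).1)) -
        (D i).2.2 * Real.exp (γ' * y) * K (h⁻¹ • (x - (D i).1)) =
        -(Real.exp ((γ' - γ) * y) - 1) *
          ((D i).2.2 * Real.exp (γ * y) * K (h⁻¹ • (x - (D i).1))) := by
      have : Real.exp (γ' * y) = Real.exp ((γ' - γ) * y) * Real.exp (γ * y) := by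
        rw [← Real.exp_add]; congr 1; ring
      rw [this]; ring
    rw [h1, abs_mul, abs_neg, abs_of_nonneg (hq γ i)]
    refine mul_le_mul_of_nonneg_right ((abs_exp_sub_one_le_exp_abs_sub_one _).trans ?_) (hq γ i)
    gcongr
    rw [abs_mul, abs_sub_comm, mul_comm]
    gcongr
    exact (hD i).1
  obtain ⟨h2, h3⟩ := etaHat_two_zero_mem hK h hD x
  have hdec : mHat K h D γ x - mHat K h D γ' x =
      (etaHat K h D 1 γ x / etaHat K h D 2 γ x - etaHat K h D 1 γ' x / etaHat K h D 2 γ' x) *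
        (1 - etaHat K h D 2 0 x) := by
    simp only [mHat]; ring
  rw [hdec, abs_mul]
  refine (mul_le_of_le_one_right (abs_nonneg _) ?_).trans hratio
  rw [abs_le]; constructor <;> linarith

/-- With the true tilt parameter, the estimator is the plug-in functional of the normalised kernel
sums of the features: the normalisation cancels in each quotient. -/
lemma abs_mHat_sub_plugIn_le {μ : Measure (EuclideanSpace ℝ (Fin d))} (hL : 0 ≤ L)
    (hK : ∀ u, 0 ≤ K u) {h : ℝ} {D : Fin n → Obs d} (hD : ∀ i, D i ∈ admissible d L) (hn : 0 < n)
    (γ : ℝ) {x : EuclideanSpace ℝ (Fin d)} (hx : 0 < kernelMass μ K h x) {κ : ℝ} (hκ : 0 < κ)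
    {m : Fin 5 → ℝ} (hm0 : m 0 = 1) (hm3 : κ ≤ m 3) (hm2 : |m 2| ≤ L * m 3) :
    |mHat K h D γ x - (m 1 + m 2 / m 3 * (1 - m 4))| ≤ (1 + 2 * L + (1 + L) / κ) *
      ∑ j, |normalizedSum μ K h (feature d L γ j) D x - m j| := by
  set c : ℝ := (n : ℝ)⁻¹ * (kernelMass μ K h x)⁻¹ with hc
  have hc0 : 0 < c := mul_pos (inv_pos.2 (by exact_mod_cast hn)) (inv_pos.2 hx)
  set k : Fin n → ℝ := fun i => K (h⁻¹ • (x - (D i).1)) with hk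
  have hk0 : ∀ i, 0 ≤ k i := fun i => hK _
  have hN : ∀ j, normalizedSum μ K h (feature d L γ j) D x =
      c * ∑ i, rawFeature d γ j (D i) * k i := by
    intro j
    rw [normalizedSum, hc, mul_assoc]
    congr 1
    rw [Finset.mul_sum]
    refine Finset.sum_congr rfl fun i _ => ?_
    rw [feature, Set.indicator_of_mem (hD i), weight]
    ring
  have r0 : ∑ i, rawFeature d γ 0 (D i) * k i = ∑ i, k i := by simp [rawFeature]
  have r1 : ∑ i, rawFeature d γ 1 (D i) * k i = ∑ i, (D i).2.2 * (D i).2.1 * k i := by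
    simp [rawFeature]
  have r2 : ∑ i, rawFeature d γ 2 (D i) * k i =
      ∑ i, (D i).2.1 * ((D i).2.2 * Real.exp (γ * (D i).2.1) * k i) := by
    refine Finset.sum_congr rfl fun i _ => ?_
    simp [rawFeature]; ring
  have r3 : ∑ i, rawFeature d γ 3 (D i) * k i =
      ∑ i, (D i).2.2 * Real.exp (γ * (D i).2.1) * k i := by
    simp [rawFeature]
  have r4 : ∑ i, rawFeature d γ 4 (D i) * k i = ∑ i, (D i).2.2 * k i := by
    simp [rawFeature]
  have hq : ∀ i, 0 ≤ (D i).2.2 * Real.exp (γ * (D i).2.1) * k i := fun i =>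
    mul_nonneg (mul_nonneg (nonneg_of_admissible (hD i)) (Real.exp_pos _).le) (hk0 i)
  have hmain : mHat K h D γ x =
      normalizedSum μ K h (feature d L γ 1) D x / normalizedSum μ K h (feature d L γ 0) D x +
      normalizedSum μ K h (feature d L γ 2) D x / normalizedSum μ K h (feature d L γ 3) D x *
        (1 - normalizedSum μ K h (feature d L γ 4) D x /
          normalizedSum μ K h (feature d L γ 0) D x) := by
    rw [mHat, etaHat_one_div_etaHat_two hK]
    simp only [hN, mul_div_mul_left _ _ hc0.ne', r0, r1, r2, r3, r4]
    simp [etaHat, hk]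
  have hle := abs_plugIn_sub_le (L := L) (κ := κ)
    (s := normalizedSum μ K h (feature d L γ 0) D x)
    (n₀ := normalizedSum μ K h (feature d L γ 1) D x)
    (n₁ := normalizedSum μ K h (feature d L γ 2) D x)
    (n₂ := normalizedSum μ K h (feature d L γ 3) D x)
    (n₃ := normalizedSum μ K h (feature d L γ 4) D x)
    (m₀ := m 1) (m₁ := m 2) (m₂ := m 3) (m₃ := m 4) hL hκ
    (by rw [hN, r0]; exact mul_nonneg hc0.le (Finset.sum_nonneg fun i _ => hk0 i))
    (by
      rw [hN, hN, r0, r1, abs_mul, abs_of_pos hc0, mul_left_comm]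
      refine mul_le_mul_of_nonneg_left (abs_sum_mul_le (fun i => ?_) hk0) hc0.le
      rw [abs_mul, abs_of_nonneg (nonneg_of_admissible (hD i))]
      exact (mul_le_of_le_one_left (abs_nonneg _) (le_one_of_admissible (hD i))).trans (hD i).1)
    (by rw [hN, r3]; exact mul_nonneg hc0.le (Finset.sum_nonneg fun i _ => hq i))
    (by
      rw [hN, hN, r2, r3, abs_mul, abs_of_pos hc0, mul_left_comm]
      exact mul_le_mul_of_nonneg_left (abs_sum_mul_le (fun i => (hD i).1) hq) hc0.le)
    (by
      rw [hN, r4]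
      exact mul_nonneg hc0.le (Finset.sum_nonneg fun i _ =>
        mul_nonneg (nonneg_of_admissible (hD i)) (hk0 i)))
    (by
      rw [hN, hN, r0, r4]
      exact mul_le_mul_of_nonneg_left (Finset.sum_le_sum fun i _ =>
        mul_le_of_le_one_left (hk0 i) (le_one_of_admissible (hD i))) hc0.le)
    hm3 hm2
  rw [hmain, Fin.sum_univ_five, hm0]
  exact hle

/-- On admissible samples the `Lᵖ` error is bounded by the `L¹` errors of the normalised kernel sums
of the features plus a term that depends only on the error of the tilt parameter. The power `p` is
reduced to `1` because estimator and target are bounded. -/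
lemma lpError_mHat_le {ν : Measure (Obs d)} [IsProbabilityMeasure ν] {b r : ℝ}
    (hK : RegularKernel volume K b r) (hL : 0 ≤ L) {γ κ : ℝ} (hκ : 0 < κ)
    (hcond : ∀ᵐ x ∂(ν.map Prod.fst), condMean ν (feature d L γ 0) x = 1 ∧
      regressionFun ν x = condMean ν (feature d L γ 1) x +
        condMean ν (feature d L γ 2) x / condMean ν (feature d L γ 3) x *
          (1 - condMean ν (feature d L γ 4) x) ∧
      κ ≤ condMean ν (feature d L γ 3) x ∧
      |condMean ν (feature d L γ 2) x| ≤ L * condMean ν (feature d L γ 3) x ∧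
      |regressionFun ν x| ≤ L)
    {h : ℝ} (hh : 0 < h) {D : Fin n → Obs d} (hD : ∀ i, D i ∈ admissible d L) (hn : 0 < n)
    (γ' : ℝ) {p : ℝ} (hp : 1 ≤ p) :
    lpError ν p (mHat K h D γ') ≤ ENNReal.ofReal ((3 * L + 1) ^ (p - 1) *
      (2 * L * (Real.exp (L * |γ' - γ|) - 1) + (1 + 2 * L + (1 + L) / κ) *
        ∑ j, l1Error (ν.map Prod.fst) K h (feature d L γ j)
          (condMean ν (feature d L γ j)) D)) := by
  have : IsProbabilityMeasure (ν.map Prod.fst) :=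
    Measure.isProbabilityMeasure_map measurable_fst.aemeasurable
  set μ := ν.map Prod.fst with hμ
  set τ := 2 * L * (Real.exp (L * |γ' - γ|) - 1) with hτ
  set c := 1 + 2 * L + (1 + L) / κ with hc
  set e : Fin 5 → EuclideanSpace ℝ (Fin d) → ℝ := fun j x =>
    |normalizedSum μ K h (feature d L γ j) D x - condMean ν (feature d L γ j) x| with he
  have hei : ∀ j, Integrable (e j) μ := fun j =>
    ((hK.integrable_normalizedSum hh _ D).sub
      (isRegression_condMean (integrable_feature hL γ j)).integrable).abs
  have hτ0 : 0 ≤ τ := mul_nonneg (by positivity) (by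
    linarith [Real.one_le_exp (by positivity : 0 ≤ L * |γ' - γ|)])
  have hpt : ∀ᵐ x ∂μ, |mHat K h D γ' x - regressionFun ν x| ^ p ≤
      (3 * L + 1) ^ (p - 1) * (τ + c * ∑ j, e j x) := by
    filter_upwards [hcond, hK.ae_kernelMass_pos (μ := μ) hh] with x ⟨h0, hr, h3, h2, hrL⟩ hx
    have h1 := abs_mHat_sub_plugIn_le (μ := μ) hL hK.nonneg hD hn γ hx hκ
      (m := fun j => condMean ν (feature d L γ j) x) h0 h3 h2
    have h4 := abs_mHat_sub_mHat_le hL hK.nonneg h hD γ' γ x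
    have h5 : |mHat K h D γ' x - regressionFun ν x| ≤ τ + c * ∑ j, e j x := by
      rw [hr, ← sub_add_sub_cancel _ (mHat K h D γ x)]
      exact (abs_add_le _ _).trans (add_le_add h4 h1)
    have h6 : |mHat K h D γ' x - regressionFun ν x| ≤ 3 * L + 1 := by
      refine (abs_sub _ _).trans ?_
      linarith [abs_mHat_le hL hK.nonneg h hD γ' x]
    set t := |mHat K h D γ' x - regressionFun ν x| with ht
    have ht0 : 0 ≤ t := abs_nonneg _
    calc t ^ p = t ^ (p - 1) * t := by
          conv_rhs => rw [← Real.rpow_one t]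
          rw [← Real.rpow_mul ht0, one_mul, ← Real.rpow_add_of_nonneg ht0 (by linarith) zero_le_one,
            sub_add_cancel]
      _ ≤ _ := by
          gcongr
  have hsum : Integrable (fun x => c * ∑ j, e j x) μ :=
    (integrable_finsetSum _ fun j _ => hei j).const_mul _
  have hint : Integrable (fun x => (3 * L + 1) ^ (p - 1) * (τ + c * ∑ j, e j x)) μ :=
    ((integrable_const τ).add hsum).const_mul _
  have hc0 : 0 ≤ c := by positivity
  calc lpError ν p (mHat K h D γ')
      ≤ ∫⁻ x, ENNReal.ofReal ((3 * L + 1) ^ (p - 1) * (τ + c * ∑ j, e j x)) ∂μ :=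
        lintegral_mono_ae (hpt.mono fun x hx => ENNReal.ofReal_le_ofReal hx)
    _ = ENNReal.ofReal (∫ x, (3 * L + 1) ^ (p - 1) * (τ + c * ∑ j, e j x) ∂μ) := by
        refine (ofReal_integral_eq_lintegral_ofReal hint (ae_of_all _ fun x => ?_)).symm
        have : 0 ≤ ∑ j, e j x := Finset.sum_nonneg fun j _ => abs_nonneg _
        simp only [Pi.zero_apply]
        positivity
    _ = _ := by
        have h7 : ∫ x, c * ∑ j, e j x ∂μ = c * ∑ j, ∫ x, e j x ∂μ := by
          rw [integral_const_mul, integral_finsetSum _ fun j _ => hei j]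
        rw [integral_const_mul, integral_add (integrable_const τ) hsum, h7]
        simp [he, l1Error]

end Estimator

lemma IsRegularKernel.exists_regularKernel {d : ℕ} {K : EuclideanSpace ℝ (Fin d) → ℝ}
    (hK : IsRegularKernel K) : ∃ b r : ℝ, RegularKernel volume K b r := by
  obtain ⟨b, hb, r, hr, hle, hint⟩ := hK.exists_ball
  exact ⟨b, r, hK.measurable, hK.nonneg, hb, hr, hle, hint.ne⟩

end NMAR

theorem theorem1 {d : ℕ}
    -- the law of `(X, Y, Δ)`: `|Y| ≤ L`, and `Δ` is an indicator
    (ν : Measure (NMAR.Obs d)) [IsProbabilityMeasure ν] (L : ℝ)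
    (hY : ∀ᵐ z ∂ν, z.2.1 ∈ Set.Icc (-L) L)
    (hΔ : ∀ᵐ z ∂ν, z.2.2 = 0 ∨ z.2.2 = 1)
    -- the missingness mechanism `π(x, y) = 1 / (1 + exp (g(x) + γ* y))`
    (g : EuclideanSpace ℝ (Fin d) → ℝ) (hg : Measurable g) (γstar : ℝ)
    (hmodel : ∀ᵐ z ∂ν, NMAR.selectionProb ν z.1 z.2.1 =
      1 / (1 + Real.exp (g z.1 + γstar * z.2.1)))
    -- the selection probability is bounded away from zero
    (hA : ∃ πmin : ℝ, 0 < πmin ∧ ∀ᵐ z ∂ν, πmin ≤ NMAR.selectionProb ν z.1 z.2.1)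
    -- the kernel and the bandwidths
    (K : EuclideanSpace ℝ (Fin d) → ℝ) (hK : NMAR.IsRegularKernel K)
    (h : ℕ → ℝ) (hpos : ∀ n, 0 < h n) (hh : Tendsto h atTop (𝓝 0))
    (hnh : Tendsto (fun n : ℕ => (n : ℝ) * h n ^ d) atTop atTop)
    -- the i.i.d. data with law `ν`, and the estimators of `γ*`
    {Ω : Type*} [MeasurableSpace Ω] (P : Measure Ω) [IsProbabilityMeasure P]
    (Z : ℕ → Ω → NMAR.Obs d) (hZ : ∀ i, HasLaw (Z i) ν P) (hindep : iIndepFun Z P)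
    (γhat : ℕ → Ω → ℝ) (hγ : ∀ n, Measurable (γhat n)) :
    ∃ c₁ > (0 : ℝ), ∃ c₃ > (0 : ℝ), ∀ ε > (0 : ℝ), ∀ p : ℝ, 1 ≤ p →
      ∃ c₂ > (0 : ℝ), ∃ C₀ > (0 : ℝ), ∀ᶠ n : ℕ in atTop,
        P.real {ω | ENNReal.ofReal ε <
            NMAR.lpError ν p (NMAR.mHat K (h n) (fun i : Fin n => Z i ω) (γhat n ω))} ≤
          c₁ * Real.exp (-c₂ * n) + c₃ * P.real {ω | C₀ < |γhat n ω - γstar|} := by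
  have hadm : ∀ᵐ z ∂ν, z ∈ NMAR.admissible d L := by
    filter_upwards [hY, hΔ] with z h1 h2 using ⟨abs_le.2 h1, h2⟩
  have hL : 0 ≤ L := by
    obtain ⟨z, hz⟩ := hadm.exists
    exact (abs_nonneg _).trans hz.1
  obtain ⟨πmin, hπ0, hπ⟩ := hA
  obtain ⟨b, r, hKr⟩ := hK.exists_regularKernel
  have hμ : IsProbabilityMeasure (ν.map Prod.fst) :=
    Measure.isProbabilityMeasure_map measurable_fst.aemeasurable
  have hcond := NMAR.ae_condMean_feature hL hadm hg hmodel hπ0 hπ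
  set κ := Real.exp (-(|γstar| * L)) * πmin with hκdef
  have hκ : 0 < κ := by positivity
  set c := 1 + 2 * L + (1 + L) / κ with hc
  have hc0 : 0 < c := by positivity
  refine ⟨5, by norm_num, 1, one_pos, fun ε hε p hp => ?_⟩
  set M := (3 * L + 1) ^ (p - 1) with hM
  have hM0 : 0 < M := Real.rpow_pos_of_pos (by linarith) _
  -- the errors allowed for the tilt parameter and for each of the five kernel sums
  have hC₀ : ∃ C₀ > 0, 2 * L * (Real.exp (L * C₀) - 1) ≤ ε / (2 * M) := by
    have hcont : Tendsto (fun t : ℝ => 2 * L * (Real.exp (L * t) - 1)) (𝓝[>] 0) (𝓝 0) := by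
      have : Continuous fun t : ℝ => 2 * L * (Real.exp (L * t) - 1) := by fun_prop
      have h1 := this.tendsto 0
      simp only [mul_zero, Real.exp_zero, sub_self] at h1
      exact h1.mono_left nhdsWithin_le_nhds
    obtain ⟨t, ht1, ht2⟩ := ((hcont.eventually_le_const
      (by positivity : 0 < ε / (2 * M))).and self_mem_nhdsWithin).exists
    exact ⟨t, ht2, ht1⟩
  obtain ⟨C₀, hC₀, hC₀le⟩ := hC₀
  set δ := ε / (10 * c * M) with hδ
  have hδ0 : 0 < δ := by positivity
  have hnh' : Tendsto (fun n : ℕ => (n : ℝ) *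
      h n ^ Module.finrank ℝ (EuclideanSpace ℝ (Fin d))) atTop atTop := by
    simpa using hnh
  choose c₂ hc₂ hexp using fun j : Fin 5 => hKr.exists_measureReal_l1Error_le hpos hh hnh' rfl
    (NMAR.measurable_feature L γstar j) (NMAR.abs_feature_le hL γstar j)
    (NMAR.isRegression_condMean (ν := ν) (NMAR.integrable_feature hL γstar j)) hδ0
  refine ⟨Finset.univ.inf' Finset.univ_nonempty c₂,
    (Finset.lt_inf'_iff _).2 fun j _ => hc₂ j, C₀, hC₀, ?_⟩
  filter_upwards [eventually_gt_atTop 0, eventually_all.2 hexp] with n hn hexpn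
  have hlaw : P.map (fun ω (i : Fin n) => Z i ω) = Measure.pi fun _ : Fin n => ν := by
    have h1 : iIndepFun (fun i : Fin n => Z i) P := hindep.precomp Fin.val_injective
    have h2 : ∀ i : Fin n, AEMeasurable (Z i) P := fun i => (hZ i).aemeasurable
    rw [h1.map_fun_eq_pi_map h2]
    congr 1
    funext i
    exact (hZ i).map_eq
  have hZm : AEMeasurable (fun ω (i : Fin n) => Z i ω) P :=
    aemeasurable_pi_lambda _ fun i => (hZ i).aemeasurable
  set J : Fin 5 → Ω → ℝ := fun j ω => NMAR.l1Error (ν.map Prod.fst) K (h n)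
    (NMAR.feature d L γstar j) (NMAR.condMean ν (NMAR.feature d L γstar j))
    (fun i : Fin n => Z i ω) with hJ
  have hJle : ∀ j, P.real {ω | δ ≤ J j ω} ≤
      Real.exp (-Finset.univ.inf' Finset.univ_nonempty c₂ * n) := by
    intro j
    have h1 : P.real {ω | δ ≤ J j ω} = (Measure.pi fun _ : Fin n => ν).real
        {D | δ ≤ NMAR.l1Error (ν.map Prod.fst) K (h n) (NMAR.feature d L γstar j)
          (NMAR.condMean ν (NMAR.feature d L γstar j)) D} := by
      rw [← hlaw, measureReal_def, measureReal_def, Measure.map_apply_of_aemeasurable hZm]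
      · rfl
      · exact measurableSet_le measurable_const (NMAR.measurable_l1Error hKr.measurable _
          (NMAR.measurable_feature L γstar j) (NMAR.measurable_condMean _) n)
    rw [h1]
    refine (hexpn j).trans (Real.exp_le_exp.2 ?_)
    have := Finset.inf'_le c₂ (Finset.mem_univ j)
    have hn' : (0 : ℝ) ≤ n := Nat.cast_nonneg n
    nlinarith
  have hadmZ : ∀ᵐ ω ∂P, ∀ i : Fin n, Z i ω ∈ NMAR.admissible d L := by
    refine ae_all_iff.2 fun i => ?_
    have h1 := (hZ i).map_eq
    rw [← h1] at hadm
    exact ae_of_ae_map (hZ i).aemeasurable hadm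
  have hsub : ∀ᵐ ω ∂P, ω ∈ {ω | ENNReal.ofReal ε <
      NMAR.lpError ν p (NMAR.mHat K (h n) (fun i : Fin n => Z i ω) (γhat n ω))} →
      ω ∈ (⋃ j, {ω | δ ≤ J j ω}) ∪ {ω | C₀ < |γhat n ω - γstar|} := by
    filter_upwards [hadmZ] with ω hω hlt
    by_contra hcon
    simp only [Set.mem_union, Set.mem_iUnion, Set.mem_ofPred_eq, not_or, not_exists, not_le,
      not_lt] at hcon
    obtain ⟨h1, h2⟩ := hcon
    refine absurd hlt (not_lt.2 ?_)
    refine (NMAR.lpError_mHat_le hKr hL hκ hcond (hpos n) hω hn (γhat n ω) hp).trans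
      (ENNReal.ofReal_le_ofReal ?_)
    have h3 : 2 * L * (Real.exp (L * |γhat n ω - γstar|) - 1) ≤ ε / (2 * M) := by
      refine le_trans ?_ hC₀le
      gcongr
    have h4 : ∑ j, J j ω ≤ 5 * δ := by
      calc _ ≤ ∑ _j : Fin 5, δ := Finset.sum_le_sum fun j _ => (h1 j).le
        _ = _ := by simp
    calc M * (2 * L * (Real.exp (L * |γhat n ω - γstar|) - 1) + c * ∑ j, J j ω)
        ≤ M * (ε / (2 * M) + c * (5 * δ)) := by gcongr
      _ = ε := by rw [hδ]; field_simp; norm_num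
  calc _ ≤ P.real ((⋃ j, {ω | δ ≤ J j ω}) ∪ {ω | C₀ < |γhat n ω - γstar|}) :=
        ENNReal.toReal_mono (measure_ne_top _ _) (measure_mono_ae hsub)
    _ ≤ P.real (⋃ j, {ω | δ ≤ J j ω}) + P.real {ω | C₀ < |γhat n ω - γstar|} :=
        measureReal_union_le _ _
    _ ≤ ∑ j, P.real {ω | δ ≤ J j ω} + P.real {ω | C₀ < |γhat n ω - γstar|} := by
        gcongr
        exact measureReal_iUnion_fintype_le _
    _ ≤ ∑ _j : Fin 5, Real.exp (-Finset.univ.inf' Finset.univ_nonempty c₂ * n) +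
        P.real {ω | C₀ < |γhat n ω - γstar|} := by
        gcongr with j
        exact hJle j
    _ = _ := by simp
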